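/- **Conventions.** Let $\mathbb K$ be a field, $\mathbb Z_+=\{1,2,\dots\}$ and $[p]=\{1,\dots,p\}$. An *$n$-dimensional Ferrers diagram* is a nonempty finite set $\mathcal D\subset\mathbb Z_+^n$ such that $\mathbf b\in\mathcal D$, $\mathbf a\in\mathbb Z_+^n$ and $a_k\le b_k$ for all $k$ imply $\mathbf a\in\mathcal D$. It is *standardizable* if, for all $\mathbf a,\mathbf b\in\mathcal D$ and $k\in[n]$ with $a_i=b_i$ for $i<k$ and $a_k<b_k$, the point $(a_1,\dots,a_k,\max\{a_{k+1},b_{k+1}\},\dots,\max\{a_n,b_n\})$ belongs to $\mathcal D$. Let $m$ be a positive integer with $a_i\le m$ for all $\mathbf a\in\mathcal D$ and $i\in[n]$, and let $R=\mathbb K[x_{i,j}: i\in[n],\,j\in[m]]$. For $\mathbf a\in\mathcal D$ put $\mathbf x_{\mathbf a}=\prod_{i=1}^n x_{i,a_i}$, and let $I_{\mathcal D}=(\mathbf x_{\mathbf a}:\mathbf a\in\mathcal D)\subseteq R$. For $r\ge1$ let $$\mathcal R\Big(\bigoplus_{i=1}^r I_{\mathcal D}\Big)=\bigoplus_{(a_1,\dots,a_r)\in\mathbb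 N^r} I_{\mathcal D}^{a_1+\cdots+a_r}\,t_1^{a_1}\cdots t_r^{a_r}\subseteq R[t_1,\dots,t_r]$$ be the multi-Rees algebra, and let $\mathcal F(\bigoplus_{i=1}^r I_{\mathcal D})=\mathcal R(\bigoplus_{i=1}^r I_{\mathcal D})\otimes_R\mathbb K$, where $\mathbb K=R/(x_{i,j}: i\in[n],\,j\in[m])$, be the special fiber ring, graded by the total degree in $t_1,\dots,t_r$. Put $\widetilde{\mathcal D_r}=\mathcal D\times[r]$, which is an $(n+1)$-dimensional Ferrers diagram. The *special fiber ideal* $\mathcal K$ is the kernel of the $\mathbb K$-algebra map $$\psi:\ T=\mathbb K[T_{\mathbf c}:\mathbf c\in\widetilde{\mathcal D_r}]\to\mathcal F\Big(\bigoplus_{i=1}^r I_{\mathcal D}\Big),\qquad T_{(\mathbf a,k)}\mapsto \mathbf x_{\mathbf a}t_k\otimes 1 .$$ Let $\sigma$ be the lexicographic monomial order on $T$ for which $T_{\mathbf a}>T_{\mathbf b}$ if and only if the first nonzero entry of $\mathbf a-\mathbf b$ is negative. For $\mathbf a,\mathbf b\in\widetilde{\mathcal D_r}$ and $H\subseteq[n+1]$,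 let $p_i=b_i$, $q_i=a_i$ if $i\in H$, and $p_i=a_i$, $q_i=b_i$ if $i\notin H$. Put $\mathbf I_H(\mathbf a,\mathbf b)=T_{\mathbf a}T_{\mathbf b}-T_{\mathbf p}T_{\mathbf q}$ if $\mathbf p,\mathbf q\in\widetilde{\mathcal D_r}$, and $\mathbf I_H(\mathbf a,\mathbf b)=0$ otherwise. Let $\mathbf I(\widetilde{\mathcal D_r})$ be the set of all nonzero $\mathbf I_H(\mathbf a,\mathbf b)$. A graded algebra $A=\bigoplus_{d\ge0}A_d$ with $A_0=\mathbb K$ is *Koszul* if its residue field $\mathbb K=A/\bigoplus_{d>0}A_d$ has a linear resolution over $A$, i.e. if there is an exact sequence $\cdots\to A(-2)^{b_2}\to A(-1)^{b_1}\to A^{b_0}\to\mathbb K\to0$ of graded $A$-modules with homogeneous maps of degree $0$ and finite ranks $b_i$. **Theorem.** Let $\mathcal D$ be a standardizable $n$-dimensional Ferrers diagram and $r\ge1$. Then $\mathbf I(\widetilde{\mathcal D_r})$ is a Gröbner basis, with respect to $\sigma$, of the special fiber ideal $\mathcal K$ of $\mathcal F(\bigoplus_{i=1}^r I_{\mathcal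 D})$. In particular, $\mathcal F(\bigoplus_{i=1}^r I_{\mathcal D})$ is Koszul. -/

import Mathlib

noncomputable section

/-- An `n`-dimensional Ferrers diagram: a nonempty finite set of lattice points in `ℤ₊ⁿ` that is
closed under passing to coordinatewise smaller points of `ℤ₊ⁿ`. -/
structure FerrersDiagram (n : ℕ) where
  carrier : Finset (Fin n → ℕ+)
  nonempty : carrier.Nonempty
  lower : ∀ b ∈ carrier, ∀ a : Fin n → ℕ+, (∀ k, a k ≤ b k) → a ∈ carrier

namespace FerrersDiagram

/-- `D` is standardizable: whenever `a, b ∈ D` agree before position `k` and `a k < b k`, the point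
`(a₁, …, a_k, max (a_{k+1}) (b_{k+1}), …, max (a_n) (b_n))` lies in `D`. -/
def IsStandardizable {n : ℕ} (D : FerrersDiagram n) : Prop :=
  ∀ a ∈ D.carrier, ∀ b ∈ D.carrier, ∀ k : Fin n,
    (∀ i < k, a i = b i) → a k < b k →
      (fun i => if i ≤ k then a i else max (a i) (b i)) ∈ D.carrier

/-- The `(n+1)`-dimensional Ferrers diagram `D × [r]`. -/
def prodInterval {n : ℕ} (D : FerrersDiagram n) (r : ℕ+) : FerrersDiagram (n + 1) where
  carrier := (D.carrier ×ˢ Finset.Icc 1 r).image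
    (fun c => (Fin.snoc c.1 c.2 : Fin (n + 1) → ℕ+))
  nonempty := (D.nonempty.product ⟨1, by simp⟩).image _
  lower := by
    intro b hb a hab
    simp only [Finset.mem_image, Finset.mem_product, Finset.mem_Icc] at hb ⊢
    obtain ⟨⟨c, k⟩, ⟨hc, -, hk⟩, rfl⟩ := hb
    refine ⟨(Fin.init a, a (Fin.last n)), ⟨D.lower c hc _ fun i => ?_, one_le, ?_⟩,
      Fin.snoc_init_self a⟩
    · simpa [Fin.init] using hab i.castSucc
    · exact le_trans (by simpa using hab (Fin.last n)) hk

theorem mem_prodInterval {n : ℕ} {D : FerrersDiagram n} {r : ℕ+} {c : Fin (n + 1) → ℕ+} :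
    c ∈ (D.prodInterval r).carrier ↔ Fin.init c ∈ D.carrier ∧ c (Fin.last n) ≤ r := by
  simp only [prodInterval, Finset.mem_image, Finset.mem_product, Finset.mem_Icc]
  constructor
  · rintro ⟨⟨a, k⟩, ⟨ha, -, hk⟩, rfl⟩
    exact ⟨by simpa using ha, by simpa using hk⟩
  · rintro ⟨h1, h2⟩
    exact ⟨(Fin.init c, c (Fin.last n)), ⟨h1, one_le, h2⟩, Fin.snoc_init_self c⟩

/-- The lattice points of `D`, as a type; they index the variables `T_a`, `a ∈ D`. -/
@[ext]
structure Point {n : ℕ} (D : FerrersDiagram n) where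
  pt : Fin n → ℕ+
  mem : pt ∈ D.carrier

/-- Points are ordered lexicographically: `a < b` iff the first nonzero entry of `a - b` is
negative. -/
instance {n : ℕ} (D : FerrersDiagram n) : LinearOrder D.Point :=
  LinearOrder.lift' (fun a => toLex a.pt) fun _ _ h => Point.ext (toLex.injective h)

instance {n : ℕ} (D : FerrersDiagram n) : Finite D.Point :=
  Finite.of_injective (fun a : D.Point => (⟨a.pt, a.mem⟩ : {a // a ∈ D.carrier}))
    fun _ _ h => Point.ext (congrArg Subtype.val h)

/-- The lexicographic monomial order `σ` on `K[T_a : a ∈ D]` in which `T_a > T_b` iff the first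
nonzero entry of `a - b` is negative. (In `MonomialOrder.lex` the variables with smaller index are
the larger ones.) -/
def sigma {n : ℕ} (D : FerrersDiagram n) : MonomialOrder D.Point := MonomialOrder.lex

/-- The tuple that has the entries of `b` at the positions in `H` and those of `a` elsewhere. -/
def swap {n : ℕ} (H : Finset (Fin n)) (a b : Fin n → ℕ+) : Fin n → ℕ+ :=
  fun i => if i ∈ H then b i else a i

/-- The interchange of `a` and `b` with respect to `H`: with `p = swap H a b` and
`q = swap H b a`, it is `T_a T_b - T_p T_q` if `p, q ∈ D`, and `0` otherwise. -/
def interchange (K : Type*) [Field K] {n : ℕ} (D : FerrersDiagram n) (H : Finset (Fin n))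
    (a b : D.Point) : MvPolynomial D.Point K :=
  if h : swap H a.pt b.pt ∈ D.carrier ∧ swap H b.pt a.pt ∈ D.carrier then
    MvPolynomial.X a * MvPolynomial.X b
      - MvPolynomial.X ⟨swap H a.pt b.pt, h.1⟩ * MvPolynomial.X ⟨swap H b.pt a.pt, h.2⟩
  else 0

/-- The set of the nonzero interchange binomials of `D`. -/
def interchanges (K : Type*) [Field K] {n : ℕ} (D : FerrersDiagram n) :
    Set (MvPolynomial D.Point K) :=
  {f | f ≠ 0 ∧ ∃ (H : Finset (Fin n)) (a b : D.Point), f = interchange K D H a b}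

end FerrersDiagram

/-- The index set `[p] = {1, …, p}`. -/
abbrev PosIndex (p : ℕ+) : Type := {j : ℕ+ // j ≤ p}

/-- The multi-Rees algebra of a family of ideals `I i` of `R`: the subalgebra of the polynomial
ring `R[t_i : i ∈ ι]` of the polynomials whose coefficient at `∏ t_i ^ a_i` lies in
`∏ I_i ^ a_i`, for all `a`. -/
def multiReesAlgebra {R : Type*} [CommRing R] {ι : Type*} (I : ι → Ideal R) :
    Subalgebra R (MvPolynomial ι R) where
  carrier := {f | ∀ a : ι →₀ ℕ, f.coeff a ∈ a.prod fun i e => I i ^ e}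
  mul_mem' := by
    classical
    intro f g hf hg a
    rw [MvPolynomial.coeff_mul]
    refine Ideal.sum_mem _ fun x hx => ?_
    rw [← Finset.HasAntidiagonal.mem_antidiagonal.mp hx,
      Finsupp.prod_add_index' (fun _ => pow_zero _) (fun _ _ _ => pow_add _ _ _)]
    exact Ideal.mul_mem_mul (hf _) (hg _)
  add_mem' := by
    intro f g hf hg a
    rw [MvPolynomial.coeff_add]
    exact Ideal.add_mem _ (hf a) (hg a)
  algebraMap_mem' := by
    classical
    intro x a
    rw [MvPolynomial.algebraMap_eq, MvPolynomial.coeff_C]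
    split_ifs with h
    · subst h
      simp
    · exact Ideal.zero_mem _

section SpecialFiber

variable {K : Type*} [Field K] {s : Type*} {ι : Type*}

/-- The extension to the multi-Rees algebra of the ideal `𝔪` of `R = K[x]` that is generated by all
the variables. -/
def specialFiberKernel (I : ι → Ideal (MvPolynomial s K)) : Ideal (multiReesAlgebra I) :=
  (Ideal.span (Set.range (MvPolynomial.X : s → MvPolynomial s K))).map
    (algebraMap (MvPolynomial s K) (multiReesAlgebra I))

/-- The special fiber ring `ℛ(⨁ I_i) ⊗_R K = ℛ(⨁ I_i) / 𝔪 ℛ(⨁ I_i)` of a family of ideals of the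
polynomial ring `R = K[x]`. -/
def SpecialFiberRing (I : ι → Ideal (MvPolynomial s K)) : Type _ :=
  multiReesAlgebra I ⧸ specialFiberKernel I

instance (I : ι → Ideal (MvPolynomial s K)) : CommRing (SpecialFiberRing I) :=
  inferInstanceAs (CommRing (multiReesAlgebra I ⧸ specialFiberKernel I))

instance (I : ι → Ideal (MvPolynomial s K)) : Algebra K (SpecialFiberRing I) :=
  inferInstanceAs (Algebra K (multiReesAlgebra I ⧸ specialFiberKernel I))

/-- The residue class map from the multi-Rees algebra to the special fiber ring. -/
def specialFiberMk (I : ι → Ideal (MvPolynomial s K)) :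
    multiReesAlgebra I →ₐ[K] SpecialFiberRing I :=
  Ideal.Quotient.mkₐ K (specialFiberKernel I)

/-- The grading of the special fiber ring by the total degree in the variables `t_i`. -/
def specialFiberGrading (I : ι → Ideal (MvPolynomial s K)) (d : ℕ) :
    Submodule K (SpecialFiberRing I) :=
  (((MvPolynomial.homogeneousSubmodule ι (MvPolynomial s K) d).comap
      (multiReesAlgebra I).val.toLinearMap).restrictScalars K).map
    (specialFiberMk I).toLinearMap

end SpecialFiber

section FerrersIdeal

variable (K : Type*) [Field K] {n : ℕ} (D : FerrersDiagram n) (m : ℕ+)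
  (hm : ∀ a ∈ D.carrier, ∀ i, a i ≤ m)

/-- The monomial `x_a = ∏ i, x_{i, a_i}` of a point `a` of `D`. -/
def ferrersMonomial (a : D.Point) : MvPolynomial (Fin n × PosIndex m) K :=
  ∏ i : Fin n, MvPolynomial.X (i, ⟨a.pt i, hm a.pt a.mem i⟩)

/-- The Ferrers ideal `I_D = (x_a : a ∈ D)` of the ring `K[x_{i,j} : i ∈ [n], j ∈ [m]]`. -/
def ferrersIdeal : Ideal (MvPolynomial (Fin n × PosIndex m) K) :=
  Ideal.span (Set.range (ferrersMonomial K D m hm))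

variable (r : ℕ+)

/-- The family `I_D, …, I_D` (`r` copies). -/
def ferrersFamily : PosIndex r → Ideal (MvPolynomial (Fin n × PosIndex m) K) :=
  fun _ => ferrersIdeal K D m hm

/-- The element `x_a t_k` of `R[t_1, …, t_r]`, for the point `(a, k)` of `D × [r]`. -/
def ferrersReesMonomial (c : (D.prodInterval r).Point) :
    MvPolynomial (PosIndex r) (MvPolynomial (Fin n × PosIndex m) K) :=
  MvPolynomial.monomial
    (Finsupp.single ⟨c.pt (Fin.last n), (FerrersDiagram.mem_prodInterval.mp c.mem).2⟩ 1)
    (ferrersMonomial K D m hm ⟨Fin.init c.pt, (FerrersDiagram.mem_prodInterval.mp c.mem).1⟩)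

theorem ferrersReesMonomial_mem (c : (D.prodInterval r).Point) :
    ferrersReesMonomial K D m hm r c ∈ multiReesAlgebra (ferrersFamily K D m hm r) := by
  classical
  intro a
  rw [ferrersReesMonomial, MvPolynomial.coeff_monomial]
  split_ifs with h
  · subst h
    simpa [ferrersFamily, ferrersIdeal] using Ideal.subset_span (Set.mem_range_self _)
  · exact Ideal.zero_mem _

/-- The presentation `ψ` of the special fiber ring of `r` copies of `I_D`: the `K`-algebra map from
`K[T_c : c ∈ D × [r]]` that sends `T_(a, k)` to the class of `x_a t_k`. -/
def specialFiberPresentation :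
    MvPolynomial (D.prodInterval r).Point K →ₐ[K]
      SpecialFiberRing (ferrersFamily K D m hm r) :=
  MvPolynomial.aeval fun c =>
    specialFiberMk (ferrersFamily K D m hm r)
      ⟨ferrersReesMonomial K D m hm r c, ferrersReesMonomial_mem K D m hm r c⟩

/-- The special fiber ideal: the kernel of the presentation `ψ`. -/
def specialFiberIdeal : Ideal (MvPolynomial (D.prodInterval r).Point K) :=
  RingHom.ker (specialFiberPresentation K D m hm r)

end FerrersIdeal

/-- `G` is a Gröbner basis of the ideal `I` with respect to the monomial order `m`: a finite subset
of `I` whose leading terms generate the initial ideal of `I`. -/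
def IsGroebnerBasis {s : Type*} {K : Type*} [Field K] (m : MonomialOrder s)
    (G : Set (MvPolynomial s K)) (I : Ideal (MvPolynomial s K)) : Prop :=
  G.Finite ∧ G ⊆ I ∧
    Ideal.span (m.leadingTerm '' (I : Set (MvPolynomial s K))) = Ideal.span (m.leadingTerm '' G)

/-- The ideal generated by the elements of positive degree. -/
def irrelevantIdeal {K A : Type*} [Field K] [CommRing A] [Algebra K A] (𝒜 : ℕ → Submodule K A) :
    Ideal A :=
  Ideal.span {x | ∃ d, 0 < d ∧ x ∈ 𝒜 d}

/-- The residue field `A / A₊` has a linear resolution over `A`: there is an exact sequence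
`⋯ → A(-2)^{b₂} → A(-1)^{b₁} → A^{b₀} → A / A₊ → 0` of graded modules. A map
`A(-i-1)^{b_{i+1}} → A(-i)^{b_i}` is homogeneous of degree `0` exactly if its matrix has
entries in `A₁`. -/
def HasLinearResolution {K A : Type*} [Field K] [CommRing A] [Algebra K A]
    (𝒜 : ℕ → Submodule K A) : Prop :=
  ∃ (b : ℕ → ℕ) (ε : (Fin (b 0) → A) →ₗ[A] (A ⧸ irrelevantIdeal 𝒜))
    (δ : ∀ i, (Fin (b (i + 1)) → A) →ₗ[A] (Fin (b i) → A)),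
    Function.Surjective ε ∧
    Function.Exact (δ 0) ε ∧
    (∀ i, Function.Exact (δ (i + 1)) (δ i)) ∧
    (∀ i (j : Fin (b (i + 1))) (k : Fin (b i)), δ i (Pi.single j 1) k ∈ 𝒜 1)

/-- The algebra `A` over the field `K`, with the subspaces `𝒜 d`, is a Koszul algebra: it is graded
by the `𝒜 d`, its component of degree `0` is `K`, and its residue field `A / A₊ = K` has a linear
resolution over `A`. -/
structure IsKoszulAlgebra {K A : Type*} [Field K] [CommRing A] [Algebra K A]
    (𝒜 : ℕ → Submodule K A) : Prop where
  nontrivial : Nontrivial A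
  gradedMonoid : SetLike.GradedMonoid 𝒜
  isInternal : DirectSum.IsInternal 𝒜
  connected : 𝒜 0 = 1
  linearResolution : HasLinearResolution 𝒜

end

/-! Since all generators of `I_D` have the same degree `n`, passing to the special fiber creates no
new relations. An element of `𝔪ℛ` has its coefficient at `t^a` in `𝔪^(n|a|+1)`, whereas the image of
a polynomial in the `T_c` has there a form of degree `n|a|`. So the special fiber ideal consists of
the relations among the monomials `x_a t_k`. If `t_k` is read as a variable attached to the last
coordinate, it is the toric ideal of `D × [r]` (`specialFiberIdeal_eq`), and `D × [r]` is again
standardizable.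

Two monomials in the `T_c` have the same toric image exactly if they have the same content.
Standardizability provides, for each nonstandard monomial, an interchange whose leading term divides
it (`exists_interchange`). Conversely, a count of the variables that agree with a given point in
their first coordinates shows that a standard monomial is the least of its content
(`not_forall_lt_of_isStandard`). Hence the leading exponent of a nonzero element of the toric ideal
is never standard, so it is divisible by the leading term of an interchange. This is the Gröbner
basis property.

The leading terms used are quadratic, and an algebra `A` with a quadratic Gröbner basis is Koszul by
a Schreyer-type construction over `A` itself. If a submodule of `A^p` has a Gröbner basis of vectors
of linear forms, with distinct leading terms, then so does its module of syzygies (`exists_next`).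
Iteration from the augmentation ideal gives a linear resolution of the residue field. -/

noncomputable section

/-! ### Standard monomials and term orders on free modules over `A` -/

section StandardMonomials

open MvPolynomial

variable {K A σ : Type*} [Field K] [CommRing A] [Algebra K A]

/-- The class in `A` of the monomial with exponent `u`, for a presentation `ψ : K[σ] → A`. -/
def monomialClass (ψ : MvPolynomial σ K →ₐ[K] A) (u : σ →₀ ℕ) : A := ψ (monomial u 1)

theorem monomialClass_zero (ψ : MvPolynomial σ K →ₐ[K] A) : monomialClass ψ 0 = 1 := by
  rw [monomialClass, ← C_apply, map_one, map_one]

theorem monomialClass_add (ψ : MvPolynomial σ K →ₐ[K] A) (u v : σ →₀ ℕ) :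
    monomialClass ψ (u + v) = monomialClass ψ u * monomialClass ψ v := by
  rw [monomialClass, monomialClass, monomialClass, ← map_mul, monomial_mul, one_mul]

/-- The exponents satisfying `P` are the standard monomials of a quadratic Gröbner basis, with
respect to `m`, of the kernel of the presentation `ψ`. -/
structure HasQuadraticStandardMonomials (ψ : MvPolynomial σ K →ₐ[K] A) (m : MonomialOrder σ)
    (P : (σ →₀ ℕ) → Prop) : Prop where
  surjective : Function.Surjective ψ
  zero : P 0
  of_le : ∀ {u v}, u ≤ v → P v → P u
  -- This field carries the quadraticity: together with `zero` and `of_le` it forces every minimal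
  -- nonstandard monomial to have degree two.
  add_single : ∀ {s d}, P s → (∀ c ∈ s.support, P (Finsupp.single c 1 + Finsupp.single d 1)) →
    P (s + Finsupp.single d 1)
  linearIndependent : LinearIndependent K fun s : {s // P s} => monomialClass ψ s.1
  straighten : ∀ u, ¬ P u → monomialClass ψ u ∈ Submodule.span K (monomialClass ψ ''
    {s | P s ∧ m.toSyn s < m.toSyn u ∧ s.degree = u.degree})

/-- The vector `T^u e_i` of the free module `A^p`. -/
abbrev monomialVec (ψ : MvPolynomial σ K →ₐ[K] A) {p : ℕ} (u : σ →₀ ℕ) (i : Fin p) : Fin p → A :=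
  Pi.single i (monomialClass ψ u)

/-- The `K`-span of the terms `T^s e_i` of the free module `A^p` with `s` standard and
`(s, i) ∈ U`. -/
def stdSpan (ψ : MvPolynomial σ K →ₐ[K] A) (P : (σ →₀ ℕ) → Prop) {p : ℕ}
    (U : Set ((σ →₀ ℕ) × Fin p)) : Submodule K (Fin p → A) :=
  Submodule.span K ((fun x => monomialVec ψ x.1 x.2) '' {x | P x.1 ∧ x ∈ U})

variable {ψ : MvPolynomial σ K →ₐ[K] A} {m : MonomialOrder σ} {P : (σ →₀ ℕ) → Prop} {p : ℕ}

theorem mem_stdSpan_mono {U V : Set ((σ →₀ ℕ) × Fin p)} {f : Fin p → A}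
    (hf : f ∈ stdSpan ψ P U) (h : ∀ y ∈ U, y ∈ V) : f ∈ stdSpan ψ P V := by
  refine Submodule.span_mono (Set.image_mono ?_) hf
  exact fun x hx => ⟨hx.1, h x hx.2⟩

theorem single_mem_stdSpan {U : Set ((σ →₀ ℕ) × Fin p)} {u : σ →₀ ℕ} {i : Fin p} (hu : P u)
    (hU : (u, i) ∈ U) : monomialVec ψ u i ∈ stdSpan ψ P U :=
  Submodule.subset_span ⟨(u, i), ⟨hu, hU⟩, rfl⟩

/-- A module term order on the terms of the free module `A^p`. -/
structure IsTermOrder (m : MonomialOrder σ)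
    (r : (σ →₀ ℕ) × Fin p → (σ →₀ ℕ) × Fin p → Prop) : Prop where
  isWellOrder : IsWellOrder _ r
  add : ∀ {u v i j} (t : σ →₀ ℕ), r (u, i) (v, j) → r (u + t, i) (v + t, j)
  of_lt : ∀ {u v} (i : Fin p), m.toSyn u < m.toSyn v → r (u, i) (v, i)

variable {r : (σ →₀ ℕ) × Fin p → (σ →₀ ℕ) × Fin p → Prop}

theorem HasQuadraticStandardMonomials.single_mem_of_not
    (h : HasQuadraticStandardMonomials ψ m P) (hr : IsTermOrder m r) {u : σ →₀ ℕ} (hu : ¬ P u)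
    (i : Fin p) : monomialVec ψ u i ∈
      stdSpan ψ P {y | r y (u, i) ∧ y.1.degree = u.degree} := by
  have := Submodule.mem_map_of_mem (f := LinearMap.single K (fun _ : Fin p => A) i)
    (h.straighten u hu)
  rw [Submodule.map_span] at this
  refine Submodule.span_mono ?_ this
  rintro _ ⟨_, ⟨s, ⟨hs, hlt, hd⟩, rfl⟩, rfl⟩
  exact ⟨(s, i), ⟨hs, hr.of_lt i hlt, hd⟩, rfl⟩

theorem HasQuadraticStandardMonomials.single_mem
    (h : HasQuadraticStandardMonomials ψ m P) (hr : IsTermOrder m r) {u : σ →₀ ℕ}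
    {i : Fin p} {x : (σ →₀ ℕ) × Fin p} (hx : r (u, i) x) {d : ℕ} (hd : u.degree = d) :
    monomialVec ψ u i ∈ stdSpan ψ P {y | r y x ∧ y.1.degree = d} := by
  have := hr.isWellOrder
  by_cases hu : P u
  · exact single_mem_stdSpan hu ⟨hx, hd⟩
  · refine mem_stdSpan_mono (h.single_mem_of_not hr hu i) ?_
    exact fun y hy => ⟨_root_.trans hy.1 hx, hy.2.trans hd⟩

theorem smul_single_monomialClass (t u : σ →₀ ℕ) (i : Fin p) :
    monomialClass ψ t • monomialVec ψ u i =
      monomialVec ψ (u + t) i := by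
  rw [← Pi.single_smul, smul_eq_mul, ← monomialClass_add, add_comm]

/-- A product of a monomial and a standard term need not be standard, but straightening replaces it
by smaller terms of the same degree, so the translated bound survives. -/
theorem HasQuadraticStandardMonomials.smul_mem
    (h : HasQuadraticStandardMonomials ψ m P) (hr : IsTermOrder m r) {u : σ →₀ ℕ}
    {i : Fin p} {d : ℕ} {f : Fin p → A} (hf : f ∈ stdSpan ψ P {y | r y (u, i) ∧ y.1.degree = d})
    (t : σ →₀ ℕ) : monomialClass ψ t • f ∈
      stdSpan ψ P {y | r y (u + t, i) ∧ y.1.degree = d + t.degree} := by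
  induction hf using Submodule.span_induction with
  | mem x hx =>
    obtain ⟨⟨s, j⟩, ⟨-, hlt, hd⟩, rfl⟩ := hx
    rw [smul_single_monomialClass]
    exact h.single_mem hr (hr.add t hlt) (by rw [map_add]; exact congrArg (· + _) hd)
  | zero => rw [smul_zero]; exact zero_mem _
  | add x y _ _ hx hy => rw [smul_add]; exact add_mem hx hy
  | smul a x _ hx => rw [smul_comm]; exact Submodule.smul_mem _ _ hx

/-- Projection to coordinate `i` reduces this to the independence of the standard monomials in `A`.
It guarantees that a leading term cannot be cancelled by the terms below it. -/
theorem HasQuadraticStandardMonomials.single_notMem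
    (h : HasQuadraticStandardMonomials ψ m P) {U : Set ((σ →₀ ℕ) × Fin p)} {s : σ →₀ ℕ}
    {i : Fin p} (hs : P s) (hU : (s, i) ∉ U) :
    monomialVec ψ s i ∉ stdSpan ψ P U := by
  intro hmem
  have hp := Submodule.mem_map_of_mem (f := LinearMap.proj (R := K) (φ := fun _ : Fin p => A) i)
    hmem
  simp only [LinearMap.proj_apply, Pi.single_eq_same] at hp
  refine h.linearIndependent.notMem_span_image (s := {s' | (s'.1, i) ∈ U}) (x := ⟨s, hs⟩) hU ?_
  refine (Submodule.map_span_le _ _ _).mpr ?_ hp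
  rintro _ ⟨⟨u, j⟩, ⟨hu, huU⟩, rfl⟩
  obtain rfl | hij := eq_or_ne j i
  · simp only [LinearMap.proj_apply, Pi.single_eq_same]
    exact Submodule.subset_span ⟨⟨u, hu⟩, huU, rfl⟩
  · simp [Pi.single_eq_of_ne hij.symm]

theorem exists_forall_rel_of_nonempty {α : Type*} (r : α → α → Prop) [IsWellOrder α r]
    {s : Finset α} (hs : s.Nonempty) : ∃ x ∈ s, ∀ y ∈ s, y ≠ x → r y x := by
  classical
  let := linearOrderOfSTO r
  exact ⟨s.max' hs, s.max'_mem hs, fun y hy hne => lt_of_le_of_ne (s.le_max' y hy) hne⟩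

theorem exists_lead_of_mem_stdSpan [IsWellOrder _ r] {U : Set ((σ →₀ ℕ) × Fin p)} {f : Fin p → A}
    (hf : f ∈ stdSpan ψ P U) : f = 0 ∨ ∃ x : (σ →₀ ℕ) × Fin p, P x.1 ∧ x ∈ U ∧ ∃ c : K, c ≠ 0 ∧
      f - c • monomialVec ψ x.1 x.2 ∈ stdSpan ψ P (U ∩ {y | r y x}) := by
  classical
  obtain ⟨l, hl, rfl⟩ := (Finsupp.mem_span_image_iff_linearCombination K).mp hf
  by_cases h0 : l = 0
  · left; simp [h0]
  right
  obtain ⟨x, hmax, hlt⟩ := exists_forall_rel_of_nonempty r (Finsupp.support_nonempty_iff.mpr h0)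
  refine ⟨x, (hl hmax).1, (hl hmax).2, l x, Finsupp.mem_support_iff.mp hmax, ?_⟩
  have hsplit : Finsupp.linearCombination K
      (fun x : (σ →₀ ℕ) × Fin p => monomialVec ψ x.1 x.2) l
      - l x • monomialVec ψ x.1 x.2 = Finsupp.linearCombination K
      (fun x : (σ →₀ ℕ) × Fin p => monomialVec ψ x.1 x.2)
        (l.erase x) := by
    conv_lhs => rw [← Finsupp.single_add_erase x l]
    rw [map_add, Finsupp.linearCombination_single]
    simp
  rw [hsplit]
  refine (Finsupp.mem_span_image_iff_linearCombination K).mpr ⟨l.erase x, ?_, rfl⟩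
  intro y hy
  rw [Finsupp.support_erase, Finset.coe_erase] at hy
  refine ⟨(hl hy.1).1, (hl hy.1).2, ?_⟩
  exact hlt y hy.1 hy.2

/-- A family `z` of vectors of linear forms in `A^p` that is a Gröbner basis of the submodule `Z`
with respect to a term order, with leading terms `T_{var j} e_{pos j}`. -/
structure LinearGroebnerFamily (ψ : MvPolynomial σ K →ₐ[K] A) (m : MonomialOrder σ)
    (P : (σ →₀ ℕ) → Prop) (p : ℕ) where
  card : ℕ
  Z : Submodule A (Fin p → A)
  z : Fin card → Fin p → A
  r : (σ →₀ ℕ) × Fin p → (σ →₀ ℕ) × Fin p → Prop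
  isTermOrder : IsTermOrder m r
  pos : Fin card → Fin p
  var : Fin card → σ
  injective : ∀ i j, pos i = pos j → var i = var j → i = j
  mem : ∀ j, z j ∈ Z
  lead : ∀ j, z j - monomialVec ψ (Finsupp.single (var j) 1) (pos j) ∈
    stdSpan ψ P {y | r y (Finsupp.single (var j) 1, pos j) ∧ y.1.degree = 1}
  groebner : ∀ f ∈ Z, ∀ s i, P s → ∀ c : K, c ≠ 0 →
    f - c • monomialVec ψ s i ∈ stdSpan ψ P {y | r y (s, i)} →
    ∃ j, pos j = i ∧ var j ∈ s.support

/-! ### Division by a linear Gröbner family -/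

namespace LinearGroebnerFamily

variable (S : LinearGroebnerFamily ψ m P p)

theorem smul_z_sub_mem (h : HasQuadraticStandardMonomials ψ m P) (j : Fin S.card)
    (t : σ →₀ ℕ) : monomialClass ψ t • S.z j -
      monomialVec ψ (t + Finsupp.single (S.var j) 1) (S.pos j) ∈ stdSpan ψ P
        {y | S.r y (t + Finsupp.single (S.var j) 1, S.pos j) ∧ y.1.degree = t.degree + 1} := by
  have := h.smul_mem S.isTermOrder (S.lead j) t
  rwa [smul_sub, smul_single_monomialClass, add_comm (Finsupp.single _ _), add_comm 1] at this

theorem smul_z_mem (h : HasQuadraticStandardMonomials ψ m P) (j : Fin S.card)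
    (t : σ →₀ ℕ) {x : (σ →₀ ℕ) × Fin p}
    (hx : S.r (t + Finsupp.single (S.var j) 1, S.pos j) x) :
    monomialClass ψ t • S.z j ∈ stdSpan ψ P {y | S.r y x ∧ y.1.degree = t.degree + 1} := by
  have := S.isTermOrder.isWellOrder
  rw [← sub_add_cancel (monomialClass ψ t • S.z j)
    (monomialVec ψ (t + Finsupp.single (S.var j) 1) (S.pos j))]
  refine add_mem (mem_stdSpan_mono (S.smul_z_sub_mem h j t)
    fun y hy => ⟨_root_.trans hy.1 hx, hy.2⟩) (h.single_mem S.isTermOrder hx (by simp))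

/-- This is the division algorithm, by well-founded induction on the leading term `x`: a suitable
multiple of some `z j` cancels it. The set `V` records a bound on the leading terms and `D` the
admissible degrees. Syzygies need both, the bound for their leading terms and the degree for their
linearity. -/
theorem mem_span_of_lead (h : HasQuadraticStandardMonomials ψ m P)
    {V : Set ((σ →₀ ℕ) × Fin p)} (hV : ∀ x y, S.r x y → y ∈ V → x ∈ V) (D : Set ℕ)
    (x : (σ →₀ ℕ) × Fin p) : P x.1 → x ∈ V → x.1.degree ∈ D → ∀ f ∈ S.Z, ∀ c : K, c ≠ 0 →
    f - c • monomialVec ψ x.1 x.2 ∈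
      stdSpan ψ P ({y | y.1.degree ∈ D} ∩ {y | S.r y x}) →
    f ∈ Submodule.span K ((fun y : (σ →₀ ℕ) × Fin S.card => monomialClass ψ y.1 • S.z y.2) ''
      {y | P y.1 ∧ (y.1 + Finsupp.single (S.var y.2) 1, S.pos y.2) ∈ V ∧ y.1.degree + 1 ∈ D}) := by
  have := S.isTermOrder.isWellOrder
  induction x using (IsWellFounded.wf (r := S.r)).induction with
  | _ x ih =>
  intro hP hxV hxD f hf c hc hfx
  obtain ⟨s, i⟩ := x
  obtain ⟨j, rfl, hj⟩ := S.groebner f hf s i hP c hc (mem_stdSpan_mono hfx (fun y hy => hy.2))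
  obtain ⟨t, rfl⟩ : ∃ t, s = t + Finsupp.single (S.var j) 1 := by
    refine ⟨s - Finsupp.single (S.var j) 1, (tsub_add_cancel_of_le ?_).symm⟩
    rw [Finsupp.single_le_iff]
    exact Nat.one_le_iff_ne_zero.mpr (Finsupp.mem_support_iff.mp hj)
  have hdeg : (t + Finsupp.single (S.var j) 1).degree = t.degree + 1 := by simp
  simp only [hdeg] at hxD
  have hterm : c • monomialClass ψ t • S.z j ∈ Submodule.span K
      ((fun y : (σ →₀ ℕ) × Fin S.card => monomialClass ψ y.1 • S.z y.2) ''
      {y | P y.1 ∧ (y.1 + Finsupp.single (S.var y.2) 1, S.pos y.2) ∈ V ∧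
        y.1.degree + 1 ∈ D}) :=
    -- The quotient `t` divides the standard monomial `s`, so it is standard as well.
    Submodule.smul_mem _ _ (Submodule.subset_span
      ⟨(t, j), ⟨h.of_le (self_le_add_right _ _) hP, hxV, hxD⟩, rfl⟩)
  have hg : f - c • monomialClass ψ t • S.z j ∈ stdSpan ψ P
      ({y | y.1.degree ∈ D} ∩ {y | S.r y (t + Finsupp.single (S.var j) 1, S.pos j)}) := by
    have h2 := Submodule.smul_mem _ c (S.smul_z_sub_mem h j t)
    have h3 := sub_mem hfx (mem_stdSpan_mono h2 fun y hy =>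
      ⟨show y.1.degree ∈ D from hy.2 ▸ hxD, hy.1⟩)
    convert h3 using 1
    rw [smul_sub]
    abel
  have hgZ : f - c • monomialClass ψ t • S.z j ∈ S.Z :=
    sub_mem hf (Submodule.smul_of_tower_mem _ c (Submodule.smul_mem _ _ (S.mem j)))
  rw [← sub_add_cancel f (c • monomialClass ψ t • S.z j)]
  refine add_mem ?_ hterm
  rcases exists_lead_of_mem_stdSpan (r := S.r) hg with h0 | ⟨x, hx, ⟨hxD', hxr⟩, c', hc', hx'⟩
  · rw [h0]; exact zero_mem _
  · exact ih x hxr hx (hV _ _ hxr hxV) hxD' _ hgZ c' hc'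
      (mem_stdSpan_mono hx' (fun y hy => ⟨hy.1.1, hy.2⟩))

theorem mem_span_of_mem (h : HasQuadraticStandardMonomials ψ m P)
    {V : Set ((σ →₀ ℕ) × Fin p)} (hV : ∀ x y, S.r x y → y ∈ V → x ∈ V) (D : Set ℕ)
    {f : Fin p → A} (hf : f ∈ S.Z) (hfV : f ∈ stdSpan ψ P (V ∩ {y | y.1.degree ∈ D})) :
    f ∈ Submodule.span K ((fun y : (σ →₀ ℕ) × Fin S.card => monomialClass ψ y.1 • S.z y.2) ''
      {y | P y.1 ∧ (y.1 + Finsupp.single (S.var y.2) 1, S.pos y.2) ∈ V ∧ y.1.degree + 1 ∈ D}) := by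
  have := S.isTermOrder.isWellOrder
  rcases exists_lead_of_mem_stdSpan (r := S.r) hfV with h0 | ⟨x, hx, ⟨hxV, hxD⟩, c, hc, hx'⟩
  · rw [h0]; exact zero_mem _
  · exact S.mem_span_of_lead h hV D x hx hxV hxD f hf c hc
      (mem_stdSpan_mono hx' (fun y hy => ⟨hy.1.2, hy.2⟩))

end LinearGroebnerFamily

theorem HasQuadraticStandardMonomials.monomialClass_mem_span
    (h : HasQuadraticStandardMonomials ψ m P) (u : σ →₀ ℕ) : monomialClass ψ u ∈
      Submodule.span K (monomialClass ψ '' {s | P s ∧ s.degree = u.degree}) := by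
  by_cases hu : P u
  · exact Submodule.subset_span ⟨u, ⟨hu, rfl⟩, rfl⟩
  · refine Submodule.span_mono (Set.image_mono ?_) (h.straighten u hu)
    exact fun s hs => ⟨hs.1, hs.2.2⟩

theorem HasQuadraticStandardMonomials.span_monomialClass
    (h : HasQuadraticStandardMonomials ψ m P) :
    Submodule.span K (monomialClass ψ '' {s | P s}) = ⊤ := by
  rw [eq_top_iff]
  rintro a -
  obtain ⟨f, rfl⟩ := h.surjective a
  induction f using MvPolynomial.induction_on' with
  | monomial u c =>
    have : ψ (monomial u c) = c • monomialClass ψ u := by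
      rw [monomialClass, ← map_smul, smul_monomial, smul_eq_mul, mul_one]
    rw [this]
    exact Submodule.smul_mem _ _ (Submodule.span_mono (Set.image_mono fun s hs => hs.1)
      (h.monomialClass_mem_span u))
  | add f g hf hg => rw [map_add]; exact add_mem hf hg

theorem HasQuadraticStandardMonomials.mem_stdSpan_univ
    (h : HasQuadraticStandardMonomials ψ m P) (f : Fin p → A) : f ∈ stdSpan ψ P Set.univ := by
  rw [← Finset.univ_sum_single f]
  refine sum_mem fun i _ => ?_
  have := Submodule.mem_map_of_mem (f := LinearMap.single K (fun _ : Fin p => A) i)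
    (show f i ∈ Submodule.span K (monomialClass ψ '' {s | P s}) from
      h.span_monomialClass ▸ Submodule.mem_top)
  rw [Submodule.map_span] at this
  refine Submodule.span_mono ?_ this
  rintro _ ⟨_, ⟨s, hs, rfl⟩, rfl⟩
  exact ⟨(s, i), ⟨hs, trivial⟩, rfl⟩

namespace LinearGroebnerFamily

variable (S : LinearGroebnerFamily ψ m P p)

theorem span_range_z (h : HasQuadraticStandardMonomials ψ m P) :
    Submodule.span A (Set.range S.z) = S.Z := by
  refine le_antisymm (Submodule.span_le.mpr (Set.range_subset_iff.mpr S.mem)) fun f hf => ?_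
  have := S.mem_span_of_mem h (V := Set.univ) (fun _ _ _ _ => trivial) Set.univ hf
    (mem_stdSpan_mono (h.mem_stdSpan_univ f) (fun _ _ => ⟨trivial, trivial⟩))
  refine (?_ : _ ≤ (Submodule.span A (Set.range S.z)).restrictScalars K) this
  rw [Submodule.span_le]
  rintro _ ⟨y, -, rfl⟩
  exact Submodule.smul_mem _ _ (Submodule.subset_span (Set.mem_range_self y.2))

end LinearGroebnerFamily

/-! ### Syzygies of a linear Gröbner family, in the Schreyer order -/

namespace LinearGroebnerFamily

variable (S : LinearGroebnerFamily ψ m P p)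

/-- The linear map `A^card → A^p` with columns `z`. -/
def map : (Fin S.card → A) →ₗ[A] (Fin p → A) := Fintype.linearCombination A S.z

theorem map_monomialVec (t : σ →₀ ℕ) (j : Fin S.card) :
    S.map (monomialVec ψ t j) = monomialClass ψ t • S.z j :=
  Fintype.linearCombination_apply_single A S.z j _

theorem map_smul_of_tower (c : K) (f : Fin S.card → A) : S.map (c • f) = c • S.map f :=
  LinearMap.map_smul_of_tower _ c f

theorem range_map (h : HasQuadraticStandardMonomials ψ m P) : LinearMap.range S.map = S.Z := by
  rw [map, Fintype.range_linearCombination, S.span_range_z h]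

/-- The leading term of the image of a term, together with the index of the term. -/
def schreyerKey (y : (σ →₀ ℕ) × Fin S.card) : ((σ →₀ ℕ) × Fin p) × Fin S.card :=
  ((y.1 + Finsupp.single (S.var y.2) 1, S.pos y.2), y.2)

/-- The Schreyer order on the terms of `A^card`. -/
def schreyer (x y : (σ →₀ ℕ) × Fin S.card) : Prop :=
  Prod.Lex S.r (· < ·) (S.schreyerKey x) (S.schreyerKey y)

theorem schreyerKey_injective : Function.Injective S.schreyerKey := by
  rintro ⟨u, i⟩ ⟨v, j⟩ h
  simp only [schreyerKey, Prod.mk.injEq] at h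
  obtain ⟨⟨h1, -⟩, rfl⟩ := h
  rw [add_right_cancel h1]

theorem isTermOrder_schreyer : IsTermOrder m S.schreyer where
  isWellOrder := by
    have := S.isTermOrder.isWellOrder
    exact (RelEmbedding.preimage ⟨_, S.schreyerKey_injective⟩
      (Prod.Lex S.r (· < ·))).isWellOrder
  add := by
    intro u v i j t h
    simp only [schreyer, schreyerKey, Prod.lex_def] at h ⊢
    rw [add_right_comm u, add_right_comm v]
    rcases h with h | ⟨h, hij⟩
    · exact Or.inl (S.isTermOrder.add t h)
    · rw [Prod.mk.injEq] at h
      exact Or.inr ⟨by rw [h.1, h.2], hij⟩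
  of_lt := by
    intro u v i h
    refine Prod.Lex.left _ _ (S.isTermOrder.of_lt _ ?_)
    rw [map_add, map_add]
    exact add_lt_add_left h _

/-- The pairs `(j, c)` for which `T_c e_j` is the leading term of a syzygy. -/
def IsSyzygyLead (q : Fin S.card × σ) : Prop :=
  ¬ P (Finsupp.single q.2 1 + Finsupp.single (S.var q.1) 1) ∨
    ∃ j < q.1, S.pos j = S.pos q.1 ∧ S.var j = q.2

/-- Division with the degree fixed to two makes the quotients linear, and the order bound keeps the
leading terms of their products with the `z j` below `x`. -/
theorem exists_lift (h : HasQuadraticStandardMonomials ψ m P) {x : (σ →₀ ℕ) × Fin p}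
    {f : Fin p → A} (hf : f ∈ S.Z) (hfx : f ∈ stdSpan ψ P {y | S.r y x ∧ y.1.degree = 2}) :
    ∃ g ∈ stdSpan ψ P {y : (σ →₀ ℕ) × Fin S.card |
      S.r (S.schreyerKey y).1 x ∧ y.1.degree = 1}, S.map g = f := by
  have := S.isTermOrder.isWellOrder
  have hmem := S.mem_span_of_mem h (V := {y | S.r y x}) (fun a b hab hb => _root_.trans hab hb)
    {2} hf (mem_stdSpan_mono hfx fun y hy => hy)
  refine (?_ : _ ≤ (stdSpan ψ P {y : (σ →₀ ℕ) × Fin S.card |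
      S.r (S.schreyerKey y).1 x ∧ y.1.degree = 1}).map (S.map.restrictScalars K)) hmem
  rw [Submodule.span_le]
  rintro _ ⟨y, ⟨hP, hr, hd⟩, rfl⟩
  exact ⟨monomialVec ψ y.1 y.2, single_mem_stdSpan hP ⟨hr, Nat.succ_injective hd⟩,
    S.map_monomialVec _ _⟩

/-- There are two sources. If `T_c T_(var j)` is nonstandard, straightening pushes all of `T_c z_j`
below that term. Otherwise an earlier `z_i` with the same position and leading variable `c` makes
the leading terms of `T_c z_j` and `T_(var j) z_i` cancel. In both cases the remainder is an element
of `Z` of degree two, and it lifts to smaller terms. -/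
theorem exists_syzygy (h : HasQuadraticStandardMonomials ψ m P) (q : Fin S.card × σ)
    (hq : S.IsSyzygyLead q) : ∃ g ∈ stdSpan ψ P {y : (σ →₀ ℕ) × Fin S.card |
      S.schreyer y (Finsupp.single q.2 1, q.1) ∧ y.1.degree = 1},
      S.map (monomialVec ψ (Finsupp.single q.2 1) q.1 - g) = 0 := by
  have := S.isTermOrder.isWellOrder
  obtain ⟨j, c⟩ := q
  by_cases hP : P (Finsupp.single c 1 + Finsupp.single (S.var j) 1)
  · obtain ⟨i, hij, hpos, hvar⟩ := hq.resolve_left (not_not.mpr hP)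
    simp only at hij hpos hvar
    have h1 := S.smul_z_sub_mem h j (Finsupp.single c 1)
    have h2 := S.smul_z_sub_mem h i (Finsupp.single (S.var j) 1)
    rw [hpos, hvar, add_comm (Finsupp.single (S.var j) 1)] at h2
    rw [Finsupp.degree_single] at h1 h2
    have h3 := sub_mem h1 h2
    rw [sub_sub_sub_cancel_right] at h3
    obtain ⟨g, hg, hgf⟩ := S.exists_lift h (sub_mem (Submodule.smul_mem _ _ (S.mem j))
      (Submodule.smul_mem _ _ (S.mem i))) (mem_stdSpan_mono h3 fun y hy => hy)
    refine ⟨g + monomialVec ψ (Finsupp.single (S.var j) 1) i, add_mem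
      (mem_stdSpan_mono hg fun y hy => ⟨Prod.Lex.left _ _ hy.1, hy.2⟩)
      (single_mem_stdSpan (h.of_le (self_le_add_left _ _) hP) ⟨?_, by simp⟩), ?_⟩
    -- The terms `T_(var j) e_i` and `T_c e_j` have images with equal leading terms, so the tie is
    -- broken by `i < j`.
    · rw [schreyer, schreyerKey, schreyerKey, Prod.lex_def]
      exact Or.inr ⟨by simp [hpos, hvar, add_comm], hij⟩
    · rw [map_sub, map_add, hgf, map_monomialVec, map_monomialVec]
      abel
  · have h1 := add_mem (S.smul_z_sub_mem h j (Finsupp.single c 1)) (mem_stdSpan_mono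
      (h.single_mem_of_not S.isTermOrder hP (S.pos j)) fun y hy => ⟨hy.1, by simpa using hy.2⟩)
    rw [sub_add_cancel] at h1
    obtain ⟨g, hg, hgf⟩ := S.exists_lift h (Submodule.smul_mem _ _ (S.mem j))
      (mem_stdSpan_mono h1 fun y hy => ⟨hy.1, by simpa using hy.2⟩)
    refine ⟨g, mem_stdSpan_mono hg fun y hy => ⟨Prod.Lex.left _ _ hy.1, hy.2⟩, ?_⟩
    rw [map_sub, hgf, map_monomialVec, sub_self]

/-- If no variable of `s` gave a syzygy lead, then `s + var i` would be standard by quadraticity. No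
other term of `f` could reach this leading term of the image, so it could not cancel, contradicting
`S.map f = 0`. -/
theorem exists_isSyzygyLead (h : HasQuadraticStandardMonomials ψ m P) {f : Fin S.card → A}
    (hf : S.map f = 0) {s : σ →₀ ℕ} {i : Fin S.card} (hs : P s) {c : K} (hc : c ≠ 0)
    (hlead : f - c • monomialVec ψ s i ∈ stdSpan ψ P {y | S.schreyer y (s, i)}) :
    ∃ d ∈ s.support, S.IsSyzygyLead (i, d) := by
  have := S.isTermOrder.isWellOrder
  by_contra! hno
  have hstd : P (s + Finsupp.single (S.var i) 1) := by
    refine h.add_single hs fun d hd => ?_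
    by_contra hd'
    exact hno d hd (Or.inl hd')
  refine h.single_notMem (p := p) (i := S.pos i)
    (U := {y | S.r y (s + Finsupp.single (S.var i) 1, S.pos i)}) hstd
    (irrefl_of S.r _) ?_
  have hrest : S.map (f - c • monomialVec ψ s i) ∈
      stdSpan ψ P {y | S.r y (s + Finsupp.single (S.var i) 1, S.pos i)} := by
    refine (?_ : _ ≤ (stdSpan ψ P {y | S.r y (s + Finsupp.single (S.var i) 1, S.pos i)}).comap
      (S.map.restrictScalars K)) hlead
    rw [stdSpan, Submodule.span_le]
    rintro _ ⟨⟨t, j⟩, ⟨ht, hlt⟩, rfl⟩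
    change S.map (monomialVec ψ t j) ∈
      stdSpan ψ P {y | S.r y (s + Finsupp.single (S.var i) 1, S.pos i)}
    rw [map_monomialVec]
    change S.schreyer _ _ at hlt
    rw [schreyer, schreyerKey, schreyerKey, Prod.lex_def] at hlt
    rcases hlt with hlt | ⟨heq, hji⟩
    · exact mem_stdSpan_mono (S.smul_z_mem h j t hlt) fun y hy => hy.1
    · rw [Prod.mk.injEq] at heq
      refine (hno (S.var j) ?_ (Or.inr ⟨j, hji, heq.2, rfl⟩)).elim
      -- In the tie `t + var j = s + var i`, distinctness of the leading terms gives `var i ≠ var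
      -- j`. Hence `var j` divides `s`, and `j < i` makes it a syzygy lead.
      have hne : S.var i ≠ S.var j := fun hv =>
        hji.ne (S.injective j i heq.2 hv.symm)
      have := DFunLike.congr_fun heq.1 (S.var j)
      simp only [Finsupp.add_apply, Finsupp.single_eq_same,
        Finsupp.single_eq_of_ne hne.symm] at this
      rw [Finsupp.mem_support_iff]
      omega
  rw [map_sub, hf, zero_sub, map_smul_of_tower, map_monomialVec] at hrest
  have hz := mem_stdSpan_mono (S.smul_z_sub_mem h i s) fun y hy => hy.1
  have h1 := (Submodule.smul_mem_iff _ hc).mp (neg_mem_iff.mp hrest)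
  have h2 := sub_mem h1 hz
  rwa [sub_sub_cancel] at h2

/-- The family has one syzygy for each pair in `IsSyzygyLead`. There are finitely many pairs, and
distinct pairs have distinct leading terms. -/
theorem exists_next [Finite σ] (h : HasQuadraticStandardMonomials ψ m P) :
    ∃ T : LinearGroebnerFamily ψ m P S.card, T.Z = LinearMap.ker S.map := by
  classical
  obtain ⟨k, ⟨e⟩⟩ := Finite.exists_equiv_fin {q : Fin S.card × σ // S.IsSyzygyLead q}
  choose g hg hg0 using fun q : {q : Fin S.card × σ // S.IsSyzygyLead q} =>
    S.exists_syzygy h q.1 q.2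
  refine ⟨{
    card := k
    Z := LinearMap.ker S.map
    z := fun j => monomialVec ψ (Finsupp.single (e.symm j).1.2 1) (e.symm j).1.1 - g (e.symm j)
    r := S.schreyer
    isTermOrder := S.isTermOrder_schreyer
    pos := fun j => (e.symm j).1.1
    var := fun j => (e.symm j).1.2
    injective := fun i j h1 h2 => e.symm.injective (Subtype.ext (Prod.ext h1 h2))
    mem := fun j => hg0 _
    lead := fun j => ?_
    groebner := fun f hf s i hs c hc hlead => ?_ }, rfl⟩
  · rw [sub_sub_cancel_left]
    exact neg_mem (hg _)
  · obtain ⟨d, hd, hq⟩ := S.exists_isSyzygyLead h hf hs hc hlead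
    exact ⟨e ⟨(i, d), hq⟩, by simp, by simpa using hd⟩

theorem z_mem (j : Fin S.card) (k : Fin p) : S.z j k ∈
    Submodule.span K (monomialClass ψ '' {u | u.degree = 1}) := by
  have hmon : ∀ (u : σ →₀ ℕ) (i : Fin p), u.degree = 1 → monomialVec ψ u i k ∈
      Submodule.span K (monomialClass ψ '' {u | u.degree = 1}) := by
    intro u i hu
    obtain rfl | hik := eq_or_ne i k
    · rw [monomialVec, Pi.single_eq_same]
      exact Submodule.subset_span ⟨u, hu, rfl⟩
    · rw [monomialVec, Pi.single_eq_of_ne hik.symm]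
      exact zero_mem _
  have hle : ∀ f ∈ stdSpan ψ P {y : (σ →₀ ℕ) × Fin p | y.1.degree = 1}, f k ∈
      Submodule.span K (monomialClass ψ '' {u | u.degree = 1}) := by
    intro f hf
    rw [stdSpan] at hf
    induction hf using Submodule.span_induction with
    | mem x hx =>
      obtain ⟨⟨s, i⟩, ⟨-, hs⟩, rfl⟩ := hx
      exact hmon s i hs
    | zero => exact zero_mem _
    | add x y _ _ hx hy => exact add_mem hx hy
    | smul a x _ hx => exact Submodule.smul_mem _ _ hx
  rw [← sub_add_cancel (S.z j)
    (monomialVec ψ (Finsupp.single (S.var j) 1) (S.pos j)), Pi.add_apply]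
  exact add_mem (hle _ (mem_stdSpan_mono (S.lead j) fun y hy => hy.2)) (hmon _ _ (by simp))

end LinearGroebnerFamily

/-! ### The augmentation ideal and the resolution of the residue field -/

/-- The ideal of the elements without constant term. -/
def augmentationIdeal (ψ : MvPolynomial σ K →ₐ[K] A) : Ideal A :=
  Ideal.span (Set.range fun c => monomialClass ψ (Finsupp.single c 1))

theorem monomialClass_mem_augmentationIdeal {u : σ →₀ ℕ} (hu : u ≠ 0) :
    monomialClass ψ u ∈ augmentationIdeal ψ := by
  obtain ⟨c, hc⟩ := Finsupp.ne_iff.mp hu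
  have hle : Finsupp.single c 1 ≤ u := by
    rw [Finsupp.single_le_iff]
    exact Nat.one_le_iff_ne_zero.mpr hc
  rw [← tsub_add_cancel_of_le hle, monomialClass_add]
  exact Ideal.mul_mem_left _ _ (Ideal.subset_span ⟨c, rfl⟩)

theorem HasQuadraticStandardMonomials.mem_span_of_mem_augmentationIdeal
    (h : HasQuadraticStandardMonomials ψ m P) {a : A} (ha : a ∈ augmentationIdeal ψ) :
    a ∈ Submodule.span K (monomialClass ψ '' {s | P s ∧ s ≠ 0}) := by
  have hmon : ∀ u : σ →₀ ℕ, u ≠ 0 →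
      monomialClass ψ u ∈ Submodule.span K (monomialClass ψ '' {s | P s ∧ s ≠ 0}) := by
    intro u hu
    refine Submodule.span_mono (Set.image_mono ?_) (h.monomialClass_mem_span u)
    rintro s ⟨hs, hd⟩
    refine ⟨hs, ?_⟩
    rintro rfl
    rw [map_zero, eq_comm, Finsupp.degree_eq_zero_iff] at hd
    exact hu hd
  rw [augmentationIdeal] at ha
  induction ha using Submodule.span_induction with
  | mem x hx =>
    obtain ⟨c, rfl⟩ := hx
    exact hmon _ (by simp)
  | zero => exact zero_mem _
  | add x y _ _ hx hy => exact add_mem hx hy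
  | smul a x _ hx =>
    have ha : a ∈ Submodule.span K (monomialClass ψ '' {s | P s}) :=
      h.span_monomialClass ▸ Submodule.mem_top
    have := Submodule.mul_mem_mul ha hx
    rw [Submodule.span_mul_span] at this
    refine (Submodule.span_le.mpr ?_ : _ ≤ _) this
    rintro _ ⟨_, ⟨u, -, rfl⟩, _, ⟨v, ⟨-, hv⟩, rfl⟩, rfl⟩
    change monomialClass ψ u * monomialClass ψ v ∈ _
    rw [← monomialClass_add]
    exact hmon _ (by simp [hv])

theorem HasQuadraticStandardMonomials.one_notMem_augmentationIdeal
    (h : HasQuadraticStandardMonomials ψ m P) : (1 : A) ∉ augmentationIdeal ψ := by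
  intro h1
  have h2 := h.mem_span_of_mem_augmentationIdeal h1
  refine h.linearIndependent.notMem_span_image (s := {s | s.1 ≠ 0}) (x := ⟨0, h.zero⟩)
    (fun h' => h' rfl) ?_
  rw [monomialClass_zero]
  refine Submodule.span_mono ?_ h2
  rintro _ ⟨s, ⟨hs, hs0⟩, rfl⟩
  exact ⟨⟨s, hs⟩, hs0, rfl⟩

/-- This starts the iteration. The variables form a Gröbner basis of the augmentation ideal because
every nonconstant monomial contains a variable and the ideal does not contain `1`. -/
theorem HasQuadraticStandardMonomials.exists_augmentationIdeal_family [Finite σ]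
    (h : HasQuadraticStandardMonomials ψ m P) : ∃ T : LinearGroebnerFamily ψ m P 1,
      ∀ f, f ∈ T.Z ↔ f 0 ∈ augmentationIdeal ψ := by
  obtain ⟨k, ⟨e⟩⟩ := Finite.exists_equiv_fin σ
  refine ⟨{
    card := k
    Z := Submodule.comap (LinearMap.proj (R := A) (φ := fun _ : Fin 1 => A) 0)
      (augmentationIdeal ψ)
    z := fun j => monomialVec ψ (Finsupp.single (e.symm j) 1) 0
    r := fun x y => m.toSyn x.1 < m.toSyn y.1
    isTermOrder := ⟨?_, fun {u v i j} t hlt => ?_, fun _ hlt => hlt⟩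
    pos := fun _ => 0
    var := e.symm
    injective := fun i j _ hij => e.symm.injective hij
    mem := fun j => ?_
    lead := fun j => ?_
    groebner := fun f hf s i hs c hc hlead => ?_ }, fun f => Iff.rfl⟩
  · have hinj : Function.Injective fun x : (σ →₀ ℕ) × Fin 1 => m.toSyn x.1 := fun x y hxy =>
      Prod.ext (m.toSyn.injective hxy) (Subsingleton.elim _ _)
    exact (RelEmbedding.preimage ⟨_, hinj⟩ (· < ·)).isWellOrder
  · simp only [map_add] at hlt ⊢
    exact add_lt_add_left hlt _
  · exact Ideal.subset_span (by simp)
  · rw [sub_self]; exact zero_mem _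
  · have hs0 : s ≠ 0 := by
      rintro rfl
      -- No term is smaller than the constant one, so an element with constant leading term is a
      -- nonzero scalar.
      have hempty : f - c • monomialVec ψ 0 i = 0 := by
        refine (Submodule.mem_bot K).mp ((Submodule.span_le.mpr ?_ : _ ≤ _) hlead)
        rintro _ ⟨x, ⟨-, hx⟩, rfl⟩
        exact absurd hx (not_lt_of_ge (m.toSyn_monotone (zero_le : 0 ≤ x.1)))
      rw [sub_eq_zero] at hempty
      subst hempty
      refine h.one_notMem_augmentationIdeal ?_
      have hf' : c • monomialVec ψ 0 i 0 ∈ augmentationIdeal ψ := hf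
      rw [Subsingleton.elim i 0, monomialVec, Pi.single_eq_same, monomialClass_zero] at hf'
      have := Ideal.mul_mem_left _ (algebraMap K A c⁻¹) hf'
      rwa [← Algebra.smul_def, smul_smul, inv_mul_cancel₀ hc, one_smul] at this
    obtain ⟨d, hd⟩ := Finsupp.support_nonempty_iff.mpr hs0
    exact ⟨e d, Subsingleton.elim _ _, by simp [hd]⟩

variable {𝒜 : ℕ → Submodule K A}

theorem irrelevantIdeal_eq_augmentationIdeal
    (h𝒜 : ∀ d, 𝒜 d = Submodule.span K (monomialClass ψ '' {u | u.degree = d})) :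
    irrelevantIdeal 𝒜 = augmentationIdeal ψ := by
  refine le_antisymm (Ideal.span_le.mpr ?_) (Ideal.span_mono ?_)
  · rintro x ⟨d, hd, hx⟩
    rw [h𝒜] at hx
    refine (Submodule.span_le.mpr ?_ :
      _ ≤ (augmentationIdeal ψ).restrictScalars K) hx
    rintro _ ⟨u, hu, rfl⟩
    refine monomialClass_mem_augmentationIdeal ?_
    rintro rfl
    exact hd.ne ((map_zero _).symm.trans hu)
  · rintro _ ⟨c, rfl⟩
    refine ⟨1, one_pos, ?_⟩
    rw [h𝒜]
    exact Submodule.subset_span ⟨_, by simp, rfl⟩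

theorem HasQuadraticStandardMonomials.hasLinearResolution [Finite σ]
    (h : HasQuadraticStandardMonomials ψ m P)
    (h𝒜 : ∀ d, 𝒜 d = Submodule.span K (monomialClass ψ '' {u | u.degree = d})) :
    HasLinearResolution 𝒜 := by
  obtain ⟨T₀, hT₀⟩ := h.exists_augmentationIdeal_family
  choose next hnext using fun (p : ℕ) (S : LinearGroebnerFamily ψ m P p) => S.exists_next h
  -- The rank of each free module is the number of generators found one step before, so ranks and
  -- families are produced together.
  let T : ℕ → Σ p, LinearGroebnerFamily ψ m P p :=
    fun i => Nat.rec ⟨1, T₀⟩ (fun _ S => ⟨S.2.card, next S.1 S.2⟩) i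
  refine ⟨fun i => (T i).1,
    (Submodule.mkQ (irrelevantIdeal 𝒜)).comp (LinearMap.proj (φ := fun _ : Fin 1 => A) 0),
    fun i => (T i).2.map, ?_, ?_, fun i => ?_, fun i j k => ?_⟩
  · intro x
    obtain ⟨a, rfl⟩ := Submodule.mkQ_surjective _ x
    exact ⟨fun _ => a, rfl⟩
  · rw [LinearMap.exact_iff]
    refine Eq.trans ?_ (T₀.range_map h).symm
    ext f
    rw [hT₀, ← irrelevantIdeal_eq_augmentationIdeal h𝒜]
    exact Submodule.Quotient.mk_eq_zero _
  · rw [LinearMap.exact_iff, ← hnext]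
    exact ((next _ (T i).2).range_map h).symm
  · have := (T i).2.z_mem j k
    rw [← h𝒜] at this
    have hz : (T i).2.map (Pi.single j 1) = (T i).2.z j := by
      have := (T i).2.map_monomialVec 0 j
      rwa [monomialVec, monomialClass_zero, one_smul] at this
    exact hz ▸ this

/-- The standard monomials are a `K`-basis of `A`, and straightening preserves degree, so the
components are spanned by disjoint parts of this basis. -/
theorem HasQuadraticStandardMonomials.isInternal (h : HasQuadraticStandardMonomials ψ m P)
    (h𝒜 : ∀ d, 𝒜 d = Submodule.span K (monomialClass ψ '' {u | u.degree = d})) :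
    DirectSum.IsInternal 𝒜 := by
  have hstd : ∀ d, 𝒜 d = Submodule.span K
      ((fun s : {s // P s} => monomialClass ψ s.1) '' {s | s.1.degree = d}) := by
    intro d
    rw [h𝒜]
    refine le_antisymm (Submodule.span_le.mpr ?_) (Submodule.span_mono ?_)
    · rintro _ ⟨u, hu, rfl⟩
      refine Submodule.span_mono ?_ (h.monomialClass_mem_span u)
      rintro _ ⟨s, ⟨hs, hd⟩, rfl⟩
      exact ⟨⟨s, hs⟩, hd.trans hu, rfl⟩
    · rintro _ ⟨s, hs, rfl⟩
      exact ⟨s.1, hs, rfl⟩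
  rw [DirectSum.isInternal_submodule_iff_iSupIndep_and_iSup_eq_top]
  constructor
  · intro d
    simp only [hstd, ← Submodule.span_iUnion, ← Set.image_iUnion]
    refine h.linearIndependent.disjoint_span_image (Set.disjoint_left.mpr fun s hs hs' => ?_)
    simp only [Set.mem_iUnion] at hs'
    obtain ⟨e, hne, he⟩ := hs'
    exact hne (he.symm.trans hs)
  · rw [eq_top_iff, ← h.span_monomialClass, Submodule.span_le]
    rintro _ ⟨s, hs, rfl⟩
    refine Submodule.mem_iSup_of_mem s.degree ?_
    rw [h𝒜]
    exact Submodule.subset_span ⟨s, rfl, rfl⟩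

/-- An algebra whose relations have a quadratic Gröbner basis is Koszul. -/
theorem HasQuadraticStandardMonomials.isKoszulAlgebra [Finite σ]
    (h : HasQuadraticStandardMonomials ψ m P)
    (h𝒜 : ∀ d, 𝒜 d = Submodule.span K (monomialClass ψ '' {u | u.degree = d})) :
    IsKoszulAlgebra 𝒜 where
  nontrivial := by
    refine ⟨0, 1, fun h01 => ?_⟩
    have := h.linearIndependent.ne_zero ⟨0, h.zero⟩
    exact this ((monomialClass_zero ψ).trans h01.symm)
  gradedMonoid :=
    { one_mem := by
        rw [h𝒜, ← monomialClass_zero ψ]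
        exact Submodule.subset_span ⟨0, map_zero _, rfl⟩
      mul_mem := by
        intro i j a b ha hb
        rw [h𝒜] at ha hb ⊢
        have := Submodule.mul_mem_mul ha hb
        rw [Submodule.span_mul_span] at this
        refine Submodule.span_mono ?_ this
        rintro _ ⟨_, ⟨u, hu, rfl⟩, _, ⟨v, hv, rfl⟩, rfl⟩
        refine ⟨u + v, ?_, monomialClass_add ψ u v⟩
        exact (map_add _ _ _).trans (congrArg₂ _ hu hv) }
  isInternal := h.isInternal h𝒜
  connected := by
    have : {u : σ →₀ ℕ | u.degree = 0} = {0} := by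
      ext u
      exact Finsupp.degree_eq_zero_iff u
    rw [h𝒜, this, Set.image_singleton, monomialClass_zero, Submodule.one_eq_span]
  linearResolution := h.hasLinearResolution h𝒜

end StandardMonomials

/-! ### Contents and standard monomials of a Ferrers diagram -/

namespace FerrersDiagram

open MvPolynomial

variable {n : ℕ} (D : FerrersDiagram n)

theorem Point.lt_iff {D : FerrersDiagram n} {a b : D.Point} :
    a < b ↔ ∃ k, (∀ i < k, a.pt i = b.pt i) ∧ a.pt k < b.pt k :=
  Iff.rfl

theorem sigma_lt_iff {D : FerrersDiagram n} {u v : D.Point →₀ ℕ} :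
    D.sigma.toSyn u < D.sigma.toSyn v ↔ ∃ c, (∀ e < c, u e = v e) ∧ u c < v c :=
  Iff.rfl

/-- The content of a monomial in the `T_a`: the multiplicities of the entries in each coordinate. -/
def content : (D.Point →₀ ℕ) →+ (Fin n × ℕ+ →₀ ℕ) :=
  Finsupp.liftAddHom fun c => multiplesHom _ (∑ i, Finsupp.single (i, c.pt i) 1)

theorem content_single (c : D.Point) (k : ℕ) :
    D.content (Finsupp.single c k) = k • ∑ i, Finsupp.single (i, c.pt i) 1 := by
  simp [content]

open Classical in
/-- The number of variables of a monomial whose index satisfies `Q`. -/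
def count {α : Type*} (Q : α → Prop) : (α →₀ ℕ) →+ ℕ :=
  Finsupp.liftAddHom fun c => if Q c then AddMonoidHom.id ℕ else 0

open Classical in
theorem count_apply {α : Type*} (Q : α → Prop) (u : α →₀ ℕ) :
    count Q u = ∑ c ∈ u.support, if Q c then u c else 0 := by
  simp only [count, Finsupp.liftAddHom_apply, Finsupp.sum]
  refine Finset.sum_congr rfl fun c _ => ?_
  split_ifs <;> simp

open Classical in
theorem count_single {α : Type*} (Q : α → Prop) (c : α) (k : ℕ) :
    count Q (Finsupp.single c k) = if Q c then k else 0 := by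
  simp only [count, Finsupp.liftAddHom_apply_single]
  split_ifs <;> simp

theorem count_content (i : Fin n) (q : ℕ+ → Prop) (u : D.Point →₀ ℕ) :
    count (fun x : Fin n × ℕ+ => x.1 = i ∧ q x.2) (D.content u) =
      count (fun c => q (c.pt i)) u := by
  classical
  induction u using Finsupp.induction_linear with
  | zero => simp
  | add f g hf hg => simp only [map_add, hf, hg]
  | single c k =>
    rw [content_single, map_nsmul, map_sum, Finset.sum_eq_single i]
    · simp [count_single]
    · intro j _ hj
      rw [count_single, if_neg fun h => hj h.1]
    · simp

theorem count_eq_of_content_eq {D : FerrersDiagram n} {u v : D.Point →₀ ℕ}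
    (h : D.content u = D.content v) (i : Fin n) (q : ℕ+ → Prop) :
    count (fun c : D.Point => q (c.pt i)) u = count (fun c : D.Point => q (c.pt i)) v := by
  rw [← count_content, ← count_content, h]

theorem degree_eq_of_content_eq {D : FerrersDiagram (n + 1)} {u v : D.Point →₀ ℕ}
    (h : D.content u = D.content v) : u.degree = v.degree := by
  -- Each variable contributes exactly one entry to coordinate `0`, which exists because the
  -- dimension is positive.
  have := count_eq_of_content_eq h 0 fun _ => True
  simpa [count_apply, Finsupp.degree_apply] using this

/-- The monomials that are not divisible by the leading term of an interchange: if `a` and `b`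
agree before position `k` and `a k < b k`, then `b i ≤ a i` for `k < i`. -/
def IsStandard (u : D.Point →₀ ℕ) : Prop :=
  ∀ a ∈ u.support, ∀ b ∈ u.support, ∀ k, (∀ i < k, a.pt i = b.pt i) → a.pt k < b.pt k →
    ∀ i, k < i → b.pt i ≤ a.pt i

variable {D}

theorem IsStandard.of_support_subset {u v : D.Point →₀ ℕ} (h : u.support ⊆ v.support)
    (hv : D.IsStandard v) : D.IsStandard u :=
  fun a ha b hb => hv a (h ha) b (h hb)

theorem IsStandard.add_single {s : D.Point →₀ ℕ} {d : D.Point} (hs : D.IsStandard s)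
    (hd : ∀ c ∈ s.support, D.IsStandard (Finsupp.single c 1 + Finsupp.single d 1)) :
    D.IsStandard (s + Finsupp.single d 1) := by
  classical
  have hsub : ∀ c ∈ (s + Finsupp.single d 1).support, c ∈ s.support ∨ c = d := by
    intro c hc
    by_contra! h
    rw [Finsupp.mem_support_iff, Finsupp.add_apply, Finsupp.notMem_support_iff.mp h.1,
      Finsupp.single_eq_of_ne h.2] at hc
    exact hc rfl
  intro a ha b hb k hk hlt
  rcases hsub a ha with ha' | rfl <;> rcases hsub b hb with hb' | rfl
  · exact hs a ha' b hb' k hk hlt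
  · exact hd a ha' a (by simp) b (by simp) k hk hlt
  · exact hd b hb' a (by simp) b (by simp) k hk hlt
  · exact absurd hlt (lt_irrefl _)

/-- Let `N_k` count the variables that agree with `c` in the first `k` coordinates. Then `N_k(u) ≤
N_k(v)` for all `k`, by induction. For the last `k` this is absurd: `N(u)` is the positive exponent
of `c` in `u`, and `N(v) = 0`. -/
theorem not_forall_lt_of_isStandard {D : FerrersDiagram (n + 1)} {u v : D.Point →₀ ℕ}
    (hu : D.IsStandard u) (huv : D.content u = D.content v) {c : D.Point} (hc : c ∈ u.support)
    (hcu : ∀ e ∈ u.support, c ≤ e) (hcv : ∀ e ∈ v.support, c < e) : False := by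
  classical
  have key : ∀ k ≤ n + 1, count (fun e : D.Point => ∀ i, i.val < k → c.pt i = e.pt i) u ≤
      count (fun e : D.Point => ∀ i, i.val < k → c.pt i = e.pt i) v := by
    intro k hk
    induction k with
    | zero =>
      have := count_eq_of_content_eq huv 0 fun _ => True
      simpa [count_apply] using this.le
    | succ k ih =>
      let κ : Fin (n + 1) := ⟨k, hk⟩
      have hsucc : ∀ e : D.Point, (∀ i, i.val < k + 1 → c.pt i = e.pt i) ↔
          (∀ i, i.val < k → c.pt i = e.pt i) ∧ c.pt κ = e.pt κ := by
        refine fun e => ⟨fun h => ⟨fun i hi => h i (by omega), h κ (Nat.lt_succ_self k)⟩,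
          fun h i hi => ?_⟩
        rcases Nat.lt_succ_iff_lt_or_eq.mp hi with hi | hi
        · exact h.1 i hi
        · obtain rfl : i = κ := Fin.ext hi
          exact h.2
      -- In `u`, a variable whose entry at `κ` exceeds that of `c` must agree with `c` before `κ`:
      -- an earlier first difference would contradict standardness. So these variables are all
      -- counted in `N_k(u)` but not in `N_(k+1)(u)`.
      have h1 : count (fun e : D.Point => ∀ i, i.val < k + 1 → c.pt i = e.pt i) u +
          count (fun e : D.Point => c.pt κ < e.pt κ) u ≤
          count (fun e : D.Point => ∀ i, i.val < k → c.pt i = e.pt i) u := by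
        simp only [count_apply, ← Finset.sum_add_distrib]
        refine Finset.sum_le_sum fun e he => ?_
        by_cases hlt : c.pt κ < e.pt κ
        · have hag : ∀ i, i.val < k → c.pt i = e.pt i := by
            have hce : c < e := lt_of_le_of_ne (hcu e he) (by rintro rfl; exact lt_irrefl _ hlt)
            obtain ⟨l, hl, hlt'⟩ := Point.lt_iff.mp hce
            have hkl : κ ≤ l := by
              by_contra! hlk
              exact (hu c hc e he l hl hlt' κ hlk).not_gt hlt
            exact fun i hi => hl i (lt_of_lt_of_le (Fin.lt_def.mpr hi) hkl)
          rw [if_neg fun h => hlt.ne ((hsucc e).mp h).2, if_pos hlt, if_pos hag, zero_add]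
        · rw [if_neg hlt, add_zero]
          split_ifs with h2 h3
          · exact le_rfl
          · exact absurd ((hsucc e).mp h2).1 h3
          · exact Nat.zero_le _
          · exact le_rfl
      -- In `v`, a variable that agrees with `c` before `κ` has an entry at `κ` no smaller than that
      -- of `c`, since `c < e`. The numbers of strictly larger entries in `u` and `v` coincide by
      -- content.
      have h2 : count (fun e : D.Point => ∀ i, i.val < k → c.pt i = e.pt i) v ≤
          count (fun e : D.Point => ∀ i, i.val < k + 1 → c.pt i = e.pt i) v +
          count (fun e : D.Point => c.pt κ < e.pt κ) v := by
        simp only [count_apply, ← Finset.sum_add_distrib]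
        refine Finset.sum_le_sum fun e he => ?_
        by_cases hag : ∀ i, i.val < k → c.pt i = e.pt i
        · rw [if_pos hag]
          by_cases hlt : c.pt κ < e.pt κ
          · rw [if_pos hlt]
            exact Nat.le_add_left _ _
          · have heq : c.pt κ = e.pt κ := by
              obtain ⟨l, hl, hlt'⟩ := Point.lt_iff.mp (hcv e he)
              rcases lt_trichotomy l κ with h | rfl | h
              · exact absurd (hag l h) hlt'.ne
              · exact absurd hlt' hlt
              · exact hl κ h
            rw [if_pos ((hsucc e).mpr ⟨hag, heq⟩)]
            exact Nat.le_add_right _ _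
        · rw [if_neg hag]
          exact Nat.zero_le _
      have h3 := count_eq_of_content_eq huv κ fun x => c.pt κ < x
      have h4 := ih (by omega)
      omega
  have h1 := key (n + 1) le_rfl
  have h2 : count (fun e : D.Point => ∀ i : Fin (n + 1), i.val < n + 1 → c.pt i = e.pt i) v =
      0 := by
    rw [count_apply]
    refine Finset.sum_eq_zero fun e he => if_neg fun h => ?_
    exact (hcv e he).ne (Point.ext (funext fun i => h i i.2))
  rw [h2, count_apply, nonpos_iff_eq_zero, Finset.sum_eq_zero_iff] at h1
  have := h1 c hc
  rw [if_pos fun _ _ => rfl] at this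
  exact Finsupp.mem_support_iff.mp hc this

/-- A standard monomial is the least monomial of its content. -/
theorem IsStandard.le_of_content_eq {D : FerrersDiagram (n + 1)} {u v : D.Point →₀ ℕ}
    (hu : D.IsStandard u) (huv : D.content u = D.content v) :
    D.sigma.toSyn u ≤ D.sigma.toSyn v := by
  by_contra! hlt
  obtain ⟨c, hc, hcv⟩ := sigma_lt_iff.mp hlt
  -- Division by the greatest common divisor leaves two monomials of equal content: `c` is the least
  -- point of the first, and all points of the second are larger.
  have hu' : u - u ⊓ v + u ⊓ v = u := tsub_add_cancel_of_le inf_le_left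
  have hv' : v - u ⊓ v + u ⊓ v = v := tsub_add_cancel_of_le inf_le_right
  have hcont : D.content (u - u ⊓ v) = D.content (v - u ⊓ v) := by
    rw [← hu', ← hv', map_add, map_add] at huv
    simpa [hu', hv'] using huv
  refine not_forall_lt_of_isStandard (c := c) (hu.of_support_subset ?_) hcont ?_ ?_ ?_
  · intro e he
    rw [Finsupp.mem_support_iff] at he ⊢
    intro h0
    simp [h0] at he
  · simp only [Finsupp.mem_support_iff, Finsupp.tsub_apply, Finsupp.inf_apply]
    have : u c ⊓ v c = v c := inf_eq_right.mpr hcv.le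
    omega
  · intro e he
    by_contra! hec
    simp [hc e hec] at he
  · intro e he
    by_contra! hec
    rcases hec.lt_or_eq with h | rfl
    · simp [hc e h] at he
    · simp [inf_eq_right.mpr hcv.le] at he

theorem IsStandard.eq_of_content_eq {D : FerrersDiagram (n + 1)} {u v : D.Point →₀ ℕ}
    (hu : D.IsStandard u) (hv : D.IsStandard v) (huv : D.content u = D.content v) : u = v :=
  D.sigma.toSyn.injective (le_antisymm (hu.le_of_content_eq huv) (hv.le_of_content_eq huv.symm))

theorem content_single_add_single_swap (H : Finset (Fin n)) (a b p q : D.Point)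
    (hp : p.pt = swap H a.pt b.pt) (hq : q.pt = swap H b.pt a.pt) :
    D.content (Finsupp.single p 1 + Finsupp.single q 1) =
      D.content (Finsupp.single a 1 + Finsupp.single b 1) := by
  simp only [map_add, content_single, one_smul, ← Finset.sum_add_distrib]
  refine Finset.sum_congr rfl fun i _ => ?_
  rw [hp, hq, swap, swap]
  split_ifs
  · exact add_comm _ _
  · rfl

theorem exists_interchange (hD : D.IsStandardizable) {u : D.Point →₀ ℕ} (hu : ¬ D.IsStandard u) :
    ∃ (H : Finset (Fin n)) (a b p q : D.Point), p.pt = swap H a.pt b.pt ∧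
      q.pt = swap H b.pt a.pt ∧ Finsupp.single a 1 + Finsupp.single b 1 ≤ u ∧
      D.sigma.toSyn (Finsupp.single p 1 + Finsupp.single q 1) <
        D.sigma.toSyn (Finsupp.single a 1 + Finsupp.single b 1) := by
  classical
  simp only [IsStandard] at hu
  push Not at hu
  obtain ⟨a, ha, b, hb, k, hk, hlt, i, hki, hi⟩ := hu
  have hab : a < b := Point.lt_iff.mpr ⟨k, hk, hlt⟩
  -- With this choice `p` is the point with the maxima after position `k`, which standardizability
  -- puts into `D`, and `q ≤ b` coordinatewise. Both are lexicographically larger than `a`, so `T_a`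
  -- exceeds both new variables and the interchange lowers the monomial.
  let H : Finset (Fin n) := {j | k < j ∧ a.pt j < b.pt j}
  have hH : ∀ j, j ∈ H ↔ k < j ∧ a.pt j < b.pt j := by simp [H]
  have hp : swap H a.pt b.pt ∈ D.carrier := by
    convert hD a.pt a.mem b.pt b.mem k hk hlt using 1
    funext j
    simp only [swap, hH]
    rcases le_or_gt j k with hj | hj
    · rw [if_neg fun h => h.1.not_ge hj, if_pos hj]
    · rw [if_neg hj.not_ge]
      split_ifs with h
      · exact (max_eq_right h.2.le).symm
      · exact (max_eq_left (not_lt.mp fun h' => h ⟨hj, h'⟩)).symm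
  have hq : swap H b.pt a.pt ∈ D.carrier := by
    refine D.lower b.pt b.mem _ fun j => ?_
    simp only [swap, hH]
    split_ifs with h
    · exact h.2.le
    · exact le_rfl
  have hap : a < ⟨swap H a.pt b.pt, hp⟩ := by
    refine Pi.toLex_strictMono (lt_of_le_of_ne (fun j => ?_) fun h => ?_)
    · simp only [swap, hH]
      split_ifs with h
      · exact h.2.le
      · exact le_rfl
    · have := congrFun h i
      simp only [swap, hH, hki, hi, and_self, if_true] at this
      exact hi.ne this
  have haq : a < ⟨swap H b.pt a.pt, hq⟩ := by
    refine Point.lt_iff.mpr ⟨k, fun j hj => ?_, ?_⟩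
    · simp only [swap, hH, hj.not_gt, false_and, if_false]
      exact hk j hj
    · simpa only [swap, hH, lt_irrefl, false_and, if_false] using hlt
  refine ⟨H, a, b, ⟨_, hp⟩, ⟨_, hq⟩, rfl, rfl, ?_, sigma_lt_iff.mpr ⟨a, fun e he => ?_, ?_⟩⟩
  · intro e
    rw [Finsupp.mem_support_iff] at ha hb
    simp only [Finsupp.add_apply, Finsupp.single_apply]
    have := hab.ne
    split_ifs with h1 h2 h2
    · exact absurd (h1.trans h2.symm) this
    · subst h1; omega
    · subst h2; omega
    · omega
  · simp only [Finsupp.add_apply]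
    rw [Finsupp.single_eq_of_ne (he.trans hap).ne, Finsupp.single_eq_of_ne (he.trans haq).ne,
      Finsupp.single_eq_of_ne he.ne, Finsupp.single_eq_of_ne (he.trans hab).ne]
  · simp only [Finsupp.add_apply]
    rw [Finsupp.single_eq_of_ne hap.ne, Finsupp.single_eq_of_ne haq.ne,
      Finsupp.single_eq_of_ne hab.ne, Finsupp.single_eq_same]
    exact Nat.one_pos

theorem exists_lt_of_not_isStandard (hD : D.IsStandardizable) {u : D.Point →₀ ℕ}
    (hu : ¬ D.IsStandard u) :
    ∃ v, D.content v = D.content u ∧ D.sigma.toSyn v < D.sigma.toSyn u := by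
  obtain ⟨H, a, b, p, q, hp, hq, hle, hlt⟩ := exists_interchange hD hu
  refine ⟨u - (Finsupp.single a 1 + Finsupp.single b 1) +
    (Finsupp.single p 1 + Finsupp.single q 1), ?_, ?_⟩
  · conv_rhs => rw [← tsub_add_cancel_of_le hle]
    rw [map_add, content_single_add_single_swap H a b p q hp hq, map_add _ (u - _)]
  · conv_rhs => rw [← tsub_add_cancel_of_le hle]
    rw [map_add, map_add _ (u - _)]
    exact add_lt_add_right hlt _

theorem exists_isStandard (hD : D.IsStandardizable) (u : D.Point →₀ ℕ) :
    ∃ s, D.IsStandard s ∧ D.content s = D.content u ∧ D.sigma.toSyn s ≤ D.sigma.toSyn u := by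
  induction u using (InvImage.wf D.sigma.toSyn (wellFounded_lt (α := D.sigma.syn))).induction with
  | _ u ih =>
  by_cases hu : D.IsStandard u
  · exact ⟨u, hu, rfl, le_rfl⟩
  · obtain ⟨v, hv, hlt⟩ := exists_lt_of_not_isStandard hD hu
    obtain ⟨s, hs, hsv, hle⟩ := ih v hlt
    exact ⟨s, hs, hsv.trans hv, hle.trans hlt.le⟩

/-! ### The toric ideal of a standardizable diagram -/

variable (D) in
/-- The parametrization `T_a ↦ ∏ i, x_{i, a_i}` of the toric ring of `D`. -/
def toricMap (K : Type*) [Field K] :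
    MvPolynomial D.Point K →ₐ[K] MvPolynomial (Fin n × ℕ+) K :=
  aeval fun c => ∏ i, X (i, c.pt i)

variable {K : Type*} [Field K]

theorem toricMap_monomial (u : D.Point →₀ ℕ) (a : K) :
    D.toricMap K (monomial u a) = monomial (D.content u) a := by
  induction u using Finsupp.induction_linear generalizing a with
  | zero => rw [← C_apply, map_zero, ← C_apply]; exact (D.toricMap K).commutes a
  | add f g hf hg =>
    rw [← mul_one a, ← monomial_mul, map_mul, hf, hg, monomial_mul, map_add]
  | single c k =>
    rw [content_single, toricMap, aeval_monomial, Finsupp.prod_single_index (by simp)]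
    simp only [X, algebraMap_eq]
    rw [← monomial_sum_one, monomial_pow, one_pow, C_mul_monomial, mul_one]

theorem toricMap_interchange (H : Finset (Fin n)) (a b : D.Point) :
    D.toricMap K (interchange K D H a b) = 0 := by
  rw [interchange]
  split_ifs with h
  · simp only [X, monomial_mul, one_mul]
    rw [map_sub, toricMap_monomial, toricMap_monomial,
      content_single_add_single_swap H a b ⟨_, h.1⟩ ⟨_, h.2⟩ rfl rfl, sub_self]
  · exact map_zero _

/-- The interchange binomials of a standardizable diagram form a Gröbner basis of the toric
ideal. -/
theorem isGroebnerBasis_interchanges {D : FerrersDiagram (n + 1)} (hD : D.IsStandardizable) :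
    IsGroebnerBasis D.sigma (D.interchanges K) (RingHom.ker (D.toricMap K)) := by
  classical
  refine ⟨?_, ?_, le_antisymm (Ideal.span_le.mpr ?_) (Ideal.span_mono (Set.image_mono ?_))⟩
  · refine (Set.finite_range fun x : Finset (Fin (n + 1)) × D.Point × D.Point =>
      interchange K D x.1 x.2.1 x.2.2).subset ?_
    rintro f ⟨-, H, a, b, rfl⟩
    exact ⟨(H, a, b), rfl⟩
  · rintro f ⟨-, H, a, b, rfl⟩
    exact toricMap_interchange H a b
  · rintro _ ⟨f, hf, rfl⟩
    obtain rfl | hf0 := eq_or_ne f 0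
    · rw [MonomialOrder.leadingTerm_zero]
      exact zero_mem _
    -- If the leading exponent were standard, it would be both the largest exponent of `f` and the
    -- smallest of its content. Nothing else in `f` would have that content, and the leading
    -- coefficient would survive in the image.
    have hu : ¬ D.IsStandard (D.sigma.degree f) := by
      intro hstd
      have h0 : D.toricMap K f = 0 := hf
      rw [f.as_sum, map_sum] at h0
      have := congrArg (coeff (D.content (D.sigma.degree f))) h0
      rw [coeff_sum, Finset.sum_eq_single (D.sigma.degree f), toricMap_monomial, coeff_monomial,
        if_pos rfl, coeff_zero] at this
      · exact D.sigma.leadingCoeff_ne_zero_iff.mpr hf0 this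
      · intro v hv hne
        rw [toricMap_monomial, coeff_monomial, if_neg]
        intro hvc
        exact hne (D.sigma.toSyn.injective
          (le_antisymm (D.sigma.le_degree hv) (hstd.le_of_content_eq hvc.symm)))
      · intro h
        exact absurd (D.sigma.degree_mem_support hf0) h
    obtain ⟨H, a, b, p, q, hp, hq, hle, hlt⟩ := exists_interchange hD hu
    have hg : interchange K D H a b =
        monomial (Finsupp.single a 1 + Finsupp.single b 1) 1 -
          monomial (Finsupp.single p 1 + Finsupp.single q 1) 1 := by
      rw [interchange, dif_pos ⟨hp ▸ p.mem, hq ▸ q.mem⟩]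
      simp only [X, monomial_mul, one_mul, ← hp, ← hq]
    have hlt' : D.sigma.toSyn (D.sigma.degree
        (monomial (Finsupp.single p 1 + Finsupp.single q 1) (1 : K))) <
        D.sigma.toSyn (D.sigma.degree
          (monomial (Finsupp.single a 1 + Finsupp.single b 1) (1 : K))) := by
      simpa only [MonomialOrder.degree_monomial, one_ne_zero, if_false] using hlt
    have hlead : D.sigma.leadingTerm (interchange K D H a b) =
        monomial (Finsupp.single a 1 + Finsupp.single b 1) 1 := by
      rw [hg, MonomialOrder.leadingTerm, MonomialOrder.degree_sub_of_lt hlt',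
        MonomialOrder.leadingCoeff_sub_of_lt hlt', MonomialOrder.degree_monomial,
        if_neg one_ne_zero, MonomialOrder.leadingCoeff_monomial]
    have hmem : interchange K D H a b ∈ D.interchanges K := by
      refine ⟨fun h0 => ?_, H, a, b, rfl⟩
      rw [h0, MonomialOrder.leadingTerm_zero, eq_comm, monomial_eq_zero] at hlead
      exact one_ne_zero hlead
    have : D.sigma.leadingTerm f =
        monomial (D.sigma.degree f - (Finsupp.single a 1 + Finsupp.single b 1))
          (D.sigma.leadingCoeff f) * D.sigma.leadingTerm (interchange K D H a b) := by
      rw [hlead, monomial_mul, tsub_add_cancel_of_le hle, mul_one, MonomialOrder.leadingTerm]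
    rw [this]
    exact Ideal.mul_mem_left _ _ (Ideal.subset_span ⟨_, hmem, rfl⟩)
  · rintro f ⟨-, H, a, b, rfl⟩
    exact toricMap_interchange H a b

/-- The toric ring of a standardizable diagram has quadratic standard monomials. -/
theorem hasQuadraticStandardMonomials {D : FerrersDiagram (n + 1)} (hD : D.IsStandardizable)
    {A : Type*} [CommRing A] [Algebra K A] {ψ : MvPolynomial D.Point K →ₐ[K] A}
    (hψ : Function.Surjective ψ) (hker : RingHom.ker ψ = RingHom.ker (D.toricMap K)) :
    HasQuadraticStandardMonomials ψ D.sigma D.IsStandard where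
  surjective := hψ
  zero := fun a ha => absurd ha (by simp)
  of_le := fun h hv => hv.of_support_subset (Finsupp.support_mono h)
  add_single := IsStandard.add_single
  linearIndependent := by
    rw [linearIndependent_iff']
    intro s g hg
    have h1 : ∑ i ∈ s, g i • monomial i.1 (1 : K) ∈ RingHom.ker ψ := by
      rw [RingHom.mem_ker, map_sum, ← hg]
      exact Finset.sum_congr rfl fun i _ => map_smul ψ _ _
    rw [hker, RingHom.mem_ker, map_sum] at h1
    simp only [map_smul, toricMap_monomial] at h1
    -- Distinct standard monomials have distinct contents, so their toric images are distinct
    -- monomials.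
    have hinj : Function.Injective fun s : {s // D.IsStandard s} => D.content s.1 :=
      fun s t h => Subtype.ext (s.2.eq_of_content_eq t.2 h)
    have hli := (basisMonomials (Fin (n + 1) × ℕ+) K).linearIndependent.comp _ hinj
    rw [linearIndependent_iff'] at hli
    refine hli s g ?_
    simpa only [Function.comp, coe_basisMonomials] using h1
  straighten := by
    intro u hu
    obtain ⟨s, hs, hsu, hle⟩ := exists_isStandard hD u
    have heq : monomialClass ψ u = monomialClass ψ s := by
      have : monomial u (1 : K) - monomial s 1 ∈ RingHom.ker ψ := by
        rw [hker, RingHom.mem_ker, map_sub, toricMap_monomial, toricMap_monomial, hsu, sub_self]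
      rwa [RingHom.mem_ker, map_sub, sub_eq_zero] at this
    rw [heq]
    refine Submodule.subset_span ⟨s, ⟨hs, lt_of_le_of_ne hle fun h => hu ?_,
      degree_eq_of_content_eq hsu⟩, rfl⟩
    rwa [← D.sigma.toSyn.injective h]

/-- If the first difference is in the last coordinate, no maxima are taken and the point is `a`.
Otherwise the condition for `D` handles the initial part, and the new last entry is still at most
`r`. -/
theorem IsStandardizable.prodInterval {D : FerrersDiagram n} (hD : D.IsStandardizable) (r : ℕ+) :
    (D.prodInterval r).IsStandardizable := by
  intro a ha b hb k hk hlt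
  rw [mem_prodInterval] at ha hb ⊢
  refine ⟨?_, ?_⟩
  · induction k using Fin.lastCases with
    | last =>
      convert ha.1 using 1
      funext i
      simp [Fin.init, Fin.le_last]
    | cast k =>
      convert hD _ ha.1 _ hb.1 k (fun i hi => hk i.castSucc hi) hlt using 1
      funext i
      simp [Fin.init]
  · split_ifs
    · exact ha.2
    · exact max_le ha.2 hb.2

end FerrersDiagram

/-! ### The special fiber ideal as a toric ideal -/

section SpecialFiber

open MvPolynomial

variable {K : Type*} [Field K] {n : ℕ} {D : FerrersDiagram n} {m : ℕ+}
  {hm : ∀ a ∈ D.carrier, ∀ i, a i ≤ m} {r : ℕ+}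

variable (K D m hm r) in
/-- The `K`-algebra map `T_(a, k) ↦ x_a t_k` to the polynomial ring `R[t_1, …, t_r]`. -/
def reesPresentation : MvPolynomial (D.prodInterval r).Point K →ₐ[K]
    MvPolynomial (PosIndex r) (MvPolynomial (Fin n × PosIndex m) K) :=
  aeval (ferrersReesMonomial K D m hm r)

variable (K D m hm r) in
/-- The `K`-algebra map `T_(a, k) ↦ x_a t_k` to the multi-Rees algebra. -/
def reesLift : MvPolynomial (D.prodInterval r).Point K →ₐ[K]
    multiReesAlgebra (ferrersFamily K D m hm r) :=
  aeval fun c => ⟨ferrersReesMonomial K D m hm r c, ferrersReesMonomial_mem K D m hm r c⟩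

theorem coe_reesLift (f : MvPolynomial (D.prodInterval r).Point K) :
    (reesLift K D m hm r f : MvPolynomial (PosIndex r) (MvPolynomial (Fin n × PosIndex m) K)) =
      reesPresentation K D m hm r f := by
  have : (((multiReesAlgebra (ferrersFamily K D m hm r)).val.restrictScalars K).comp
      (reesLift K D m hm r)) = reesPresentation K D m hm r := by
    refine MvPolynomial.algHom_ext fun c => ?_
    rw [AlgHom.comp_apply, reesLift, aeval_X, reesPresentation, aeval_X]
    rfl
  exact DFunLike.congr_fun this f

theorem specialFiberPresentation_eq (f : MvPolynomial (D.prodInterval r).Point K) :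
    specialFiberPresentation K D m hm r f = specialFiberMk _ (reesLift K D m hm r f) := by
  have : specialFiberPresentation K D m hm r =
      (specialFiberMk (ferrersFamily K D m hm r)).comp (reesLift K D m hm r) := by
    refine MvPolynomial.algHom_ext fun c => ?_
    rw [AlgHom.comp_apply, reesLift, aeval_X, specialFiberPresentation, aeval_X]
  rw [this, AlgHom.comp_apply]

theorem specialFiberMk_eq_zero_iff {g : multiReesAlgebra (ferrersFamily K D m hm r)} :
    specialFiberMk _ g = 0 ↔ g ∈ specialFiberKernel (ferrersFamily K D m hm r) :=
  Ideal.Quotient.eq_zero_iff_mem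

theorem ferrersReesMonomial_eq (c : (D.prodInterval r).Point) :
    ferrersReesMonomial K D m hm r c =
      X ⟨c.pt (Fin.last n), (FerrersDiagram.mem_prodInterval.mp c.mem).2⟩ *
        C (ferrersMonomial K D m hm
          ⟨Fin.init c.pt, (FerrersDiagram.mem_prodInterval.mp c.mem).1⟩) := by
  rw [ferrersReesMonomial, X, mul_comm, C_mul_monomial, mul_one]

/-- The embedding of the variables `t_k`, `x_{i,j}` into the variables `x_{i,j}` of the toric ring
of `D × [r]`. -/
def reesVariable (n : ℕ) (m r : ℕ+) : PosIndex r ⊕ (Fin n × PosIndex m) → Fin (n + 1) × ℕ+ :=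
  Sum.elim (fun k => (Fin.last n, k.1)) fun x => (x.1.castSucc, x.2.1)

theorem reesVariable_injective (n : ℕ) (m r : ℕ+) : Function.Injective (reesVariable n m r) := by
  rintro (k | ⟨i, j⟩) (k' | ⟨i', j'⟩) h <;>
    simp only [reesVariable, Sum.elim_inl, Sum.elim_inr, Prod.mk.injEq] at h
  · rw [Subtype.ext h.2]
  · exact absurd h.1.symm (Fin.castSucc_lt_last _).ne
  · exact absurd h.1 (Fin.castSucc_lt_last _).ne
  · rw [Fin.castSucc_injective _ h.1, Subtype.ext h.2]

/-- The toric map is the Rees presentation followed by an injective renaming of variables that sends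
`t_k` to the variable with entry `k` in the last coordinate. -/
theorem ker_reesPresentation :
    RingHom.ker (reesPresentation K D m hm r) =
      RingHom.ker ((D.prodInterval r).toricMap K) := by
  have hcomp : (D.prodInterval r).toricMap K =
      (rename (reesVariable n m r)).comp
        ((sumAlgEquiv K (PosIndex r) (Fin n × PosIndex m)).symm.toAlgHom.comp
          (reesPresentation K D m hm r)) := by
    refine MvPolynomial.algHom_ext fun c => ?_
    change _ = rename (reesVariable n m r)
      ((sumAlgEquiv K (PosIndex r) (Fin n × PosIndex m)).symm (reesPresentation K D m hm r (X c)))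
    simp only [FerrersDiagram.toricMap, reesPresentation, aeval_X,
      ferrersReesMonomial_eq, ferrersMonomial, map_mul, map_prod,
      sumAlgEquiv_symm_X, sumAlgEquiv_symm_C_X, rename_X, reesVariable,
      Sum.elim_inl, Sum.elim_inr, Fin.prod_univ_castSucc]
    exact mul_comm _ _
  ext f
  rw [RingHom.mem_ker, RingHom.mem_ker, hcomp, AlgHom.comp_apply, AlgHom.comp_apply,
    map_eq_zero_iff _ (rename_injective _ (reesVariable_injective n m r))]
  exact (map_eq_zero_iff _ (sumAlgEquiv K (PosIndex r) (Fin n × PosIndex m)).symm.injective).symm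

theorem coeff_reesPresentation_isHomogeneous (f : MvPolynomial (D.prodInterval r).Point K)
    (a : PosIndex r →₀ ℕ) :
    (coeff a (reesPresentation K D m hm r f)).IsHomogeneous (n * a.degree) := by
  classical
  induction f using MvPolynomial.induction_on generalizing a with
  | C x =>
    rw [reesPresentation, aeval_C, IsScalarTower.algebraMap_apply K
      (MvPolynomial (Fin n × PosIndex m) K), algebraMap_eq, algebraMap_eq, coeff_C]
    split_ifs with h
    · subst h
      rw [map_zero, mul_zero]
      exact isHomogeneous_C _ _
    · exact isHomogeneous_zero _ _ _
  | add f g hf hg =>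
    rw [map_add, coeff_add]
    exact (hf a).add (hg a)
  | mul_X f c hf =>
    rw [map_mul, coeff_mul]
    refine IsHomogeneous.sum _ _ _ fun x hx => ?_
    rw [← Finset.HasAntidiagonal.mem_antidiagonal.mp hx, map_add, mul_add]
    refine (hf x.1).mul ?_
    rw [reesPresentation, aeval_X, ferrersReesMonomial, coeff_monomial]
    split_ifs with h
    · rw [← h, Finsupp.degree_single, mul_one, ferrersMonomial]
      simpa using IsHomogeneous.prod Finset.univ
        (fun i => (X (i, ⟨_, hm _ (FerrersDiagram.mem_prodInterval.mp c.mem).1 i⟩) :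
          MvPolynomial (Fin n × PosIndex m) K)) (fun _ => 1) fun i _ => isHomogeneous_X _ _
    · exact isHomogeneous_zero _ _ _

theorem ferrersIdeal_le : ferrersIdeal K D m hm ≤ idealOfVars (Fin n × PosIndex m) K ^ n := by
  rw [ferrersIdeal, Ideal.span_le]
  rintro _ ⟨a, rfl⟩
  rw [ferrersMonomial]
  have := Ideal.prod_mem_prod (s := Finset.univ) (I := fun _ : Fin n =>
    idealOfVars (Fin n × PosIndex m) K)
    (x := fun i => (X (i, ⟨a.pt i, hm a.pt a.mem i⟩) : MvPolynomial (Fin n × PosIndex m) K))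
    fun i _ => Ideal.subset_span ⟨_, rfl⟩
  simpa using this

/-- Since `I_D ⊆ 𝔪^n`, the coefficient at `t^a` of an element of the Rees algebra lies in
`𝔪^(n|a|)`, and the factor from `𝔪` adds one to the exponent. -/
theorem coeff_mem_of_mem_specialFiberKernel {g : multiReesAlgebra (ferrersFamily K D m hm r)}
    (hg : g ∈ specialFiberKernel (ferrersFamily K D m hm r)) (a : PosIndex r →₀ ℕ) :
    coeff a g.1 ∈ idealOfVars (Fin n × PosIndex m) K ^ (n * a.degree + 1) := by
  have hg' : g ∈ (idealOfVars (Fin n × PosIndex m) K) •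
      (⊤ : Submodule (MvPolynomial (Fin n × PosIndex m) K)
        (multiReesAlgebra (ferrersFamily K D m hm r))) := by
    rw [Ideal.smul_top_eq_map]
    exact hg
  refine Submodule.smul_induction_on hg' (fun x hx h _ => ?_) fun x y hx hy => ?_
  · change coeff a (x • h.1) ∈ _
    rw [coeff_smul, pow_succ']
    refine Ideal.mul_mem_mul hx ?_
    have hle : (a.prod fun i e => ferrersFamily K D m hm r i ^ e) ≤
        idealOfVars (Fin n × PosIndex m) K ^ (n * a.degree) := by
      simp only [ferrersFamily, Finsupp.prod, Finset.prod_pow_eq_pow_sum]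
      rw [pow_mul]
      exact Ideal.pow_right_mono ferrersIdeal_le _
    exact hle (h.2 a)
  · change coeff a (x.1 + y.1) ∈ _
    rw [coeff_add]
    exact add_mem hx hy

/-- The special fiber ideal is the toric ideal of `D × [r]`. -/
theorem specialFiberIdeal_eq :
    specialFiberIdeal K D m hm r = RingHom.ker ((D.prodInterval r).toricMap K) := by
  rw [← ker_reesPresentation (hm := hm)]
  ext f
  rw [specialFiberIdeal, RingHom.mem_ker, RingHom.mem_ker, specialFiberPresentation_eq]
  constructor
  · intro h
    ext a e
    have hmem := coeff_mem_of_mem_specialFiberKernel (specialFiberMk_eq_zero_iff.mp h) a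
    rw [coe_reesLift, mem_pow_idealOfVars_iff'] at hmem
    rw [coeff_zero, coeff_zero]
    -- A nonzero coefficient would have degree exactly `n|a|`, but membership in `𝔪^(n|a|+1)`
    -- excludes this degree.
    by_contra hne
    have hdeg : e.degree = n * a.degree := by
      rw [Finsupp.degree_eq_weight_one]
      exact coeff_reesPresentation_isHomogeneous f a hne
    exact hne (hmem e (by omega))
  · intro h
    have : reesLift K D m hm r f = 0 := Subtype.ext ((coe_reesLift f).trans h)
    rw [this, map_zero]

/-! ### Surjectivity of the presentation and the grading of the special fiber -/

variable (K D m hm r) in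
/-- The `R`-span of the images of the monomials in the `T_c` of degree `d`. -/
def reesSpan (d : ℕ) : Submodule (MvPolynomial (Fin n × PosIndex m) K)
    (MvPolynomial (PosIndex r) (MvPolynomial (Fin n × PosIndex m) K)) :=
  Submodule.span _ ((fun u => reesPresentation K D m hm r (monomial u 1)) '' {u | u.degree = d})

theorem mul_mem_reesSpan {d e : ℕ}
    {f g : MvPolynomial (PosIndex r) (MvPolynomial (Fin n × PosIndex m) K)}
    (hf : f ∈ reesSpan K D m hm r d) (hg : g ∈ reesSpan K D m hm r e) :
    f * g ∈ reesSpan K D m hm r (d + e) := by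
  have := Submodule.mul_mem_mul hf hg
  rw [reesSpan, reesSpan, Submodule.span_mul_span] at this
  refine Submodule.span_mono ?_ this
  rintro _ ⟨_, ⟨u, hu, rfl⟩, _, ⟨v, hv, rfl⟩, rfl⟩
  refine ⟨u + v, (map_add _ _ _).trans (congrArg₂ _ hu hv), ?_⟩
  change _ = reesPresentation K D m hm r _ * reesPresentation K D m hm r _
  rw [← map_mul, monomial_mul, one_mul]

theorem monomial_zero_mem_reesSpan (c : MvPolynomial (Fin n × PosIndex m) K) :
    monomial 0 c ∈ reesSpan K D m hm r 0 := by
  have h1 : (monomial 0 c : MvPolynomial (PosIndex r) (MvPolynomial (Fin n × PosIndex m) K)) =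
      c • reesPresentation K D m hm r (monomial 0 1) := by
    rw [← C_apply (σ := (D.prodInterval r).Point), map_one, map_one, ← C_apply, smul_eq_C_mul,
      mul_one]
  rw [h1]
  exact Submodule.smul_mem _ _ (Submodule.subset_span ⟨0, map_zero _, rfl⟩)

theorem monomial_single_one_mem_reesSpan (k : PosIndex r) {c : MvPolynomial (Fin n × PosIndex m) K}
    (hc : c ∈ ferrersIdeal K D m hm) :
    monomial (Finsupp.single k 1) c ∈ reesSpan K D m hm r 1 := by
  rw [ferrersIdeal] at hc
  induction hc using Submodule.span_induction with
  | mem x hx =>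
    obtain ⟨a, rfl⟩ := hx
    have hmem : (Fin.snoc a.pt k.1 : Fin (n + 1) → ℕ+) ∈ (D.prodInterval r).carrier := by
      rw [FerrersDiagram.mem_prodInterval]
      exact ⟨by simpa using a.mem, by simpa using k.2⟩
    refine Submodule.subset_span ⟨Finsupp.single ⟨_, hmem⟩ 1, by simp, ?_⟩
    change reesPresentation K D m hm r (X _) = _
    rw [reesPresentation, aeval_X, ferrersReesMonomial]
    simp
  | zero => rw [map_zero]; exact zero_mem _
  | add x y _ _ hx hy => rw [map_add]; exact add_mem hx hy
  | smul x y _ hy =>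
    rw [smul_eq_mul, ← C_mul_monomial, ← smul_eq_C_mul]
    exact Submodule.smul_mem _ _ hy

theorem monomial_single_mem_reesSpan (k : PosIndex r) (e : ℕ)
    {c : MvPolynomial (Fin n × PosIndex m) K} (hc : c ∈ ferrersIdeal K D m hm ^ e) :
    monomial (Finsupp.single k e) c ∈ reesSpan K D m hm r e := by
  induction e generalizing c with
  | zero => rw [Finsupp.single_zero]; exact monomial_zero_mem_reesSpan c
  | succ e ih =>
    rw [pow_succ] at hc
    refine Submodule.mul_induction_on hc (fun x hx y hy => ?_) fun x y hx hy => ?_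
    · rw [Finsupp.single_add, ← monomial_mul]
      exact mul_mem_reesSpan (ih hx) (monomial_single_one_mem_reesSpan k hy)
    · rw [map_add]
      exact add_mem hx hy

theorem monomial_mem_reesSpan (a : PosIndex r →₀ ℕ) {c : MvPolynomial (Fin n × PosIndex m) K}
    (hc : c ∈ a.prod fun i e => ferrersFamily K D m hm r i ^ e) :
    monomial a c ∈ reesSpan K D m hm r a.degree := by
  classical
  induction a using Finsupp.induction_linear generalizing c with
  | zero => rw [map_zero]; exact monomial_zero_mem_reesSpan c
  | add a b ha hb =>
    rw [Finsupp.prod_add_index' (fun _ => pow_zero _) (fun _ _ _ => pow_add _ _ _)] at hc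
    refine Submodule.mul_induction_on hc (fun x hx y hy => ?_) fun x y hx hy => ?_
    · rw [map_add, ← monomial_mul]
      exact mul_mem_reesSpan (ha hx) (hb hy)
    · rw [map_add (monomial (a + b))]
      exact add_mem hx hy
  | single k e =>
    rw [Finsupp.prod_single_index (h := fun i e => ferrersFamily K D m hm r i ^ e)
      (pow_zero _)] at hc
    rw [Finsupp.degree_single]
    exact monomial_single_mem_reesSpan k e hc

/-- A polynomial differs from its constant term by an element of `𝔪`, which acts as zero on the
fiber. This turns `R`-spans into `K`-spans. -/
theorem specialFiberMk_smul (c : MvPolynomial (Fin n × PosIndex m) K)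
    (g : multiReesAlgebra (ferrersFamily K D m hm r)) :
    specialFiberMk _ (c • g) = constantCoeff c • specialFiberMk _ g := by
  rw [← map_smul, ← sub_eq_zero, ← map_sub, specialFiberMk_eq_zero_iff]
  have hc : c - C (constantCoeff c) ∈ idealOfVars (Fin n × PosIndex m) K := by
    rw [← pow_one (idealOfVars _ _), mem_pow_idealOfVars_iff']
    intro x hx
    rw [Nat.lt_one_iff, Finsupp.degree_eq_zero_iff] at hx
    subst hx
    simp [constantCoeff_eq]
  have heq : c • g - constantCoeff c • g =
      algebraMap (MvPolynomial (Fin n × PosIndex m) K) _ (c - C (constantCoeff c)) * g := by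
    rw [← Algebra.smul_def, sub_smul, ← algebraMap_eq, algebraMap_smul]
  rw [heq]
  exact Ideal.mul_mem_right _ _ (Ideal.mem_map_of_mem _ hc)

/-- The set `S` of degrees serves two purposes: all degrees give surjectivity of the presentation, a
single degree gives the graded components. -/
theorem specialFiberMk_mem_span (S : Set ℕ) (g : multiReesAlgebra (ferrersFamily K D m hm r))
    (hg : ∀ a ∈ g.1.support, a.degree ∈ S) :
    specialFiberMk _ g ∈ Submodule.span K
      (monomialClass (specialFiberPresentation K D m hm r) '' {u | u.degree ∈ S}) := by
  have h1 : g ∈ Submodule.span (MvPolynomial (Fin n × PosIndex m) K)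
      ((fun u => reesLift K D m hm r (monomial u 1)) '' {u | u.degree ∈ S}) := by
    -- Membership is tested in `R[t]`, because the decomposition of `g` into terms is available
    -- there.
    rw [← Submodule.comap_map_eq_of_injective
      (f := (multiReesAlgebra (ferrersFamily K D m hm r)).val.toLinearMap) Subtype.val_injective
      (Submodule.span _ _), Submodule.mem_comap, Submodule.map_span, ← Set.image_comp]
    change g.1 ∈ _
    rw [g.1.as_sum]
    refine sum_mem fun a ha => ?_
    refine Submodule.span_mono ?_ (monomial_mem_reesSpan a (g.2 a))
    rintro _ ⟨u, hu, rfl⟩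
    exact ⟨u, (show u.degree ∈ S from hu ▸ hg a ha), coe_reesLift _⟩
  clear hg
  induction h1 using Submodule.span_induction with
  | mem x hx =>
    obtain ⟨u, hu, rfl⟩ := hx
    exact Submodule.subset_span ⟨u, hu, specialFiberPresentation_eq _⟩
  | zero => rw [map_zero]; exact zero_mem _
  | add x y _ _ hx hy => rw [map_add]; exact add_mem hx hy
  | smul c x _ hx => rw [specialFiberMk_smul]; exact Submodule.smul_mem _ _ hx

theorem specialFiberPresentation_surjective :
    Function.Surjective (specialFiberPresentation K D m hm r) := by
  intro x
  obtain ⟨g, rfl⟩ := Ideal.Quotient.mk_surjective x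
  have := specialFiberMk_mem_span Set.univ g fun _ _ => trivial
  refine (Submodule.span_le.mpr ?_ :
    _ ≤ LinearMap.range (specialFiberPresentation K D m hm r).toLinearMap) this
  rintro _ ⟨u, -, rfl⟩
  exact ⟨_, rfl⟩

theorem reesPresentation_monomial_isHomogeneous (u : (D.prodInterval r).Point →₀ ℕ) :
    (reesPresentation K D m hm r (monomial u 1)).IsHomogeneous u.degree := by
  rw [reesPresentation, aeval_monomial, map_one, one_mul, Finsupp.prod, Finsupp.degree_apply]
  refine IsHomogeneous.prod _ _ _ fun c _ => ?_
  have : (ferrersReesMonomial K D m hm r c).IsHomogeneous 1 :=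
    isHomogeneous_monomial _ (Finsupp.degree_single _ _)
  simpa using this.pow (u c)

theorem specialFiberGrading_eq (d : ℕ) :
    specialFiberGrading (ferrersFamily K D m hm r) d = Submodule.span K
      (monomialClass (specialFiberPresentation K D m hm r) '' {u | u.degree = d}) := by
  refine le_antisymm ?_ (Submodule.span_le.mpr ?_)
  · rintro _ ⟨g, hg, rfl⟩
    refine specialFiberMk_mem_span {d} g fun a ha => ?_
    have hg' : g.1.IsHomogeneous d := hg
    rw [Finsupp.degree_eq_weight_one]
    exact hg' (mem_support_iff.mp ha)
  · rintro _ ⟨u, rfl, rfl⟩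
    refine ⟨reesLift K D m hm r (monomial u 1), ?_, (specialFiberPresentation_eq _).symm⟩
    change (reesLift K D m hm r (monomial u 1)).1.IsHomogeneous u.degree
    rw [coe_reesLift]
    exact reesPresentation_monomial_isHomogeneous u

end SpecialFiber

end

theorem theorem5p7 {K : Type*} [Field K] {n : ℕ} (D : FerrersDiagram n)
    (hD : D.IsStandardizable) (m : ℕ+) (hm : ∀ a ∈ D.carrier, ∀ i, a i ≤ m) (r : ℕ+) :
    IsGroebnerBasis (D.prodInterval r).sigma ((D.prodInterval r).interchanges K)
        (specialFiberIdeal K D m hm r) ∧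
      IsKoszulAlgebra (specialFiberGrading (ferrersFamily K D m hm r)) := by
  constructor
  · rw [specialFiberIdeal_eq]
    exact FerrersDiagram.isGroebnerBasis_interchanges (hD.prodInterval r)
  · exact (FerrersDiagram.hasQuadraticStandardMonomials (hD.prodInterval r)
      specialFiberPresentation_surjective specialFiberIdeal_eq).isKoszulAlgebra
        specialFiberGrading_eq
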